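/- **Setting.** Let $d\ge 1$, $[d]=\{1,\dots,d\}$, let $B_{j\leftarrow i}$ ($i,j\in[d]$) be $\mathbb Z_{\ge 0}$-valued random variables (the number of type-$j$ children of a type-$i$ parent), and let $(\mathbf S_j)_{j\in[d]}$ be random vectors in $\mathbb R^d_+=[0,\infty)^d$ solving $\mathbf S_j\overset{\mathcal D}{=}\mathbf e_j+\sum_{i\in[d]}\sum_{m=1}^{B_{i\leftarrow j}}\mathbf S_i^{(m)}$ for all $j$, where the $\mathbf S_i^{(m)}$ are independent copies of $\mathbf S_i$, independent of each other and of $(B_{i\leftarrow j})_{i}$. Write $\|\cdot\|$ for the $L^1$ norm, and call $A$ *bounded away* from $C$ if $\inf_{x\in A,y\in C}\|x-y\|>0$. *Standing assumptions:* (1) the matrix $(\mathbf E B_{j\leftarrow i})_{j,i}$ has spectral radius $<1$; (2) $x\mapsto\mathbf P(B_{j\leftarrow i}>x)$ is regularly varying with index $-\alpha_{j\leftarrow i}$ for some $\alpha_{j\leftarrow i}>1$, and for each $i$ the variables $(B_{j\leftarrow i})_{j\in[d]}$ are independent; (3) $\bar s_{i,j}:=\mathbf E S_{i,j}\in(0,\infty)$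 for all $i,j$; (4) the numbers $\alpha_{j\leftarrow i}$ are pairwise distinct. *Notation:* $\bar{\mathbf s}_i=\mathbf E\mathbf S_i$; $\alpha^*(j)=\min_l\alpha_{j\leftarrow l}$, attained at $l^*(j)$; $\alpha(\mathbf j)=1+\sum_{i\in\mathbf j}(\alpha^*(i)-1)$ for $\emptyset\ne\mathbf j\subseteq[d]$, and $\alpha(\emptyset)=0$; $\lambda_{\mathbf j}(n)=n^{-1}\prod_{i\in\mathbf j}n\,\mathbf P(B_{i\leftarrow l^*(i)}>n)$. Let $\mathbb R^d(\mathbf j)=\{\sum_{i\in\mathbf j}w_i\bar{\mathbf s}_i:w_i\ge0\}$; for $\varepsilon\ge 0$ and $\mathbf j\neq\emptyset$ let $\bar{\mathbb R}^d(\mathbf j,\varepsilon)$ be the set of all $w\theta$ with $w\ge0$, $\theta\in\mathbb R^d_+$, $\|\theta\|=1$ and $\inf\{\|\theta-x\|:x\in\mathbb R^d(\mathbf j),\|x\|=1\}\le\varepsilon$; let $\bar{\mathbb R}^d(\emptyset,\varepsilon)=\{0\}$, $\bar{\mathbb R}^d_{\le}(\mathbf j,\varepsilon)=\bigcup_{\mathbf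 j'\ne\mathbf j,\ \alpha(\mathbf j')\le\alpha(\mathbf j)}\bar{\mathbb R}^d(\mathbf j',\varepsilon)$ and $\mathbb R^d_\le(\mathbf j)=\bar{\mathbb R}^d_\le(\mathbf j,0)$. A *type* $\mathbf I$ is a finite (possibly empty) sequence $(\mathbf j_1,\dots,\mathbf j_K)$ of nonempty, pairwise disjoint subsets of $[d]$ with $|\mathbf j_1|=1$ if $K\ge1$; let $\mathbf j^{\mathbf I}=\bigcup_k\mathbf j_k$. For nonempty $\mathcal I,\mathcal J\subseteq[d]$ let $g_{\mathcal I\leftarrow\mathcal J}(w)=\sum\prod_{i\in\mathcal I}\prod_{j\in\mathcal J(i)}w_i\bar s_{i,l^*(j)}$, the sum being over all families $(\mathcal J(i))_{i\in\mathcal I}$ of disjoint (possibly empty) sets with union $\mathcal J$. For a type with $\mathbf j_1=\{j_1\}$, $$\mathbf C_i^{\mathbf I}(\cdot)=\int \mathbf 1\Big\{\sum_{k=1}^K\sum_{j\in\mathbf j_k}w_{k,j}\bar{\mathbf s}_j\in\cdot\Big\}\;\bar s_{i,l^*(j_1)}\prod_{k=1}^{K-1}g_{\mathbf j_k\leftarrow\mathbf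 j_{k+1}}\big((w_{k,j})_{j\in\mathbf j_k}\big)\prod_{k=1}^K\prod_{j\in\mathbf j_k}\frac{\alpha^*(j)\,dw_{k,j}}{w_{k,j}^{\alpha^*(j)+1}}$$ (integral over $w_{k,j}>0$), and $\mathbf C_i^{\mathbf j}=\sum_{\mathbf I:\mathbf j^{\mathbf I}=\mathbf j}\mathbf C_i^{\mathbf I}$. For $i\in[d]$, $\emptyset\neq\mathbf j\subseteq[d]$ and Borel $A\subseteq\mathbb R^d_+$, with interior $A^\circ$ in $\mathbb R^d_+$ and closure $A^-$, consider the asymptotics $$\mathbf C_i^{\mathbf j}(A^\circ)\le\liminf_{n\to\infty}\frac{\mathbf P(n^{-1}\mathbf S_i\in A)}{\lambda_{\mathbf j}(n)}\le\limsup_{n\to\infty}\frac{\mathbf P(n^{-1}\mathbf S_i\in A)}{\lambda_{\mathbf j}(n)}\le\mathbf C_i^{\mathbf j}(A^-)<\infty.\tag{$*$}$$ **Statement (a).** Let $d=2$, and in addition to the standing assumptions suppose that for all $i,j$ the limit $\lim_{x\to\infty}x^{\alpha_{j\leftarrow i}}\mathbf P(B_{j\leftarrow i}>x)$ exists in $(0,\infty)$,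 that $\alpha_{1\leftarrow2}>\alpha_{1\leftarrow1}>2$, that $\alpha_{2\leftarrow1}>2\alpha_{1\leftarrow1}$ and $\alpha_{2\leftarrow2}>2\alpha_{1\leftarrow1}$, and that $\mathbf P(B_{2\leftarrow1}=0)>0$. Then $\alpha^*(1)>2$ and $\alpha^*(2)>2\alpha^*(1)$. Let $r>0$ and let $A$ be one of the two complements of a tube around the ray generated by $\bar{\mathbf s}_1$, $$\{x\in\mathbb R^2_+:\exists w\ge0,\ x_1=w\bar s_{1,1},\ |x_2-w\bar s_{1,2}|>r\}\quad\text{or}\quad\{x\in\mathbb R^2_+:\inf_{w\ge0}\|x-w\bar{\mathbf s}_1\|>r\}.$$ Then: 1. $\liminf_{n\to\infty}n^{2\alpha^*(1)}\,\mathbf P(n^{-1}\mathbf S_1\in A)>0$. 2. $A$ is Borel, $\mathbb R^2_\le(\{2\})=\mathbb R^2(\{1\})$, and $A$ is bounded away from $\mathbb R^2_\le(\{2\})$, but $A$ is not bounded away from $\bar{\mathbb R}^2_\le(\{2\},\varepsilon)$ for any $\varepsilon>0$. 3. $A\cap\mathbb R^2(\{2\})\ne\emptyset$, $\lim_n n^{\alpha^*(2)}\lambda_{\{2\}}(n)$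 exists in $(0,\infty)$, $\mathbf C_1^{\{2\}}(A^\circ)>0$ and $\mathbf C_1^{\{2\}}(A^-)<\infty$, so that $(*)$ with $i=1$, $\mathbf j=\{2\}$ would predict a decay of $\mathbf P(n^{-1}\mathbf S_1\in A)$ of exact order $n^{-\alpha^*(2)}$. 4. However, $n^{\alpha^*(2)}\,\mathbf P(n^{-1}\mathbf S_1\in A)\to\infty$, and $(*)$ fails for $i=1$, $\mathbf j=\{2\}$ and this $A$. **Statement (b).** Consequently, already for $d=2$, the following assertion is false: "under the standing assumptions, $(*)$ holds for all $i\in[d]$, all nonempty $\mathbf j\subseteq[d]$ and all Borel sets $A\subseteq\mathbb R^d_+$ that are bounded away from $\mathbb R^d_\le(\mathbf j)$." That is, in the theorem asserting $(*)$ for sets bounded away from $\bar{\mathbb R}^d_\le(\mathbf j,\varepsilon)$ for some $\varepsilon>0$, this condition cannot be weakened to being bounded away from $\mathbb R^d_\le(\mathbf j)$. -/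

import Mathlib

open MeasureTheory ProbabilityTheory Filter Topology
open scoped ENNReal

noncomputable section

namespace BranchingTail

/-! ### Geometry of `ℝ^d_+` -/

/-- The `L¹` norm on `ℝ^d`. -/
def l1 {d : ℕ} (x : Fin d → ℝ) : ℝ := ∑ i, |x i|

/-- The orthant `ℝ^d_+ = [0, ∞)^d`. -/
def orthant (d : ℕ) : Set (Fin d → ℝ) := {x | ∀ i, 0 ≤ x i}

/-- The `L¹` unit sphere restricted to the orthant. -/
def unitSphere (d : ℕ) : Set (Fin d → ℝ) := {x | x ∈ orthant d ∧ l1 x = 1}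

/-- `A` is bounded away from `C`: the infimum of `‖x - y‖` over `x ∈ A`, `y ∈ C` is positive
(the infimum of the empty set being `+∞`). -/
def BoundedAway {d : ℕ} (A C : Set (Fin d → ℝ)) : Prop :=
  ∃ r : ℝ, 0 < r ∧ ∀ x ∈ A, ∀ y ∈ C, r ≤ l1 (x - y)

/-- The interior of `A` in the metric space `ℝ^d_+`. -/
def orthantInterior {d : ℕ} (A : Set (Fin d → ℝ)) : Set (Fin d → ℝ) :=
  {x | x ∈ orthant d ∧ A ∈ 𝓝[orthant d] x}

/-- The convex cone `ℝ^d(𝐣)` generated by the vectors `s i`, `i ∈ 𝐣`. -/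
def cone {d : ℕ} (s : Fin d → Fin d → ℝ) (J : Finset (Fin d)) : Set (Fin d → ℝ) :=
  {x | ∃ w : Fin d → ℝ, (∀ i, 0 ≤ w i) ∧ x = ∑ i ∈ J, w i • s i}

/-- The cone enlarged by an `ε`-perturbation of the angles, with the convention that it is `{0}`
for the empty index set. The infimum over the empty set is `+∞`. -/
def enlargedCone {d : ℕ} (s : Fin d → Fin d → ℝ) (J : Finset (Fin d)) (ε : ℝ) :
    Set (Fin d → ℝ) :=
  {x | (J = ∅ ∧ x = 0) ∨
    (J.Nonempty ∧ ∃ w : ℝ, 0 ≤ w ∧ ∃ θ ∈ unitSphere d, x = w • θ ∧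
      ⨅ y ∈ cone s J ∩ unitSphere d, ENNReal.ofReal (l1 (θ - y)) ≤ ENNReal.ofReal ε)}

/-- The union of the `ε`-enlarged cones over all `𝐣' ≠ 𝐣` with `a 𝐣' ≤ a 𝐣`, where `a` is the
collection of tail indices. -/
def coneLe {d : ℕ} (s : Fin d → Fin d → ℝ) (a : Finset (Fin d) → ℝ) (J : Finset (Fin d))
    (ε : ℝ) : Set (Fin d → ℝ) :=
  {x | ∃ J' : Finset (Fin d), J' ≠ J ∧ a J' ≤ a J ∧ x ∈ enlargedCone s J' ε}

/-! ### Tail indices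

Throughout, an array `α j i` (or `B j i`) stands for `α_{j ← i}` (or `B_{j ← i}`): a type-`j`
child of a type-`i` parent. -/

/-- `l*(j)`, a minimiser of `l ↦ α_{j ← l}` (the minimiser whenever the `α_{j ← l}` differ). -/
def lStar {d : ℕ} [NeZero d] (α : Fin d → Fin d → ℝ) (j : Fin d) : Fin d :=
  (Finite.exists_min (α j)).choose

/-- `α*(j) = min_l α_{j ← l}`. -/
def alphaStar {d : ℕ} [NeZero d] (α : Fin d → Fin d → ℝ) (j : Fin d) : ℝ :=
  Finset.univ.inf' Finset.univ_nonempty (α j)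

/-- `α(𝐣) = 1 + ∑_{i ∈ 𝐣} (α*(i) - 1)` for nonempty `𝐣`, and `α(∅) = 0`. -/
def tailIndex {d : ℕ} [NeZero d] (α : Fin d → Fin d → ℝ) (J : Finset (Fin d)) : ℝ :=
  if J = ∅ then 0 else 1 + ∑ i ∈ J, (alphaStar α i - 1)

/-! ### The model -/

/-- A measurable function `φ : (0, ∞) → (0, ∞)` is regularly varying with index `β` at `∞`. -/
def RegularlyVarying (φ : ℝ → ℝ) (β : ℝ) : Prop :=
  Measurable (fun x : Set.Ioi (0 : ℝ) => φ x) ∧ (∀ x, 0 < x → 0 < φ x) ∧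
    ∀ t : ℝ, 0 < t → Tendsto (fun x => φ (t * x) / φ x) atTop (𝓝 (t ^ β))

section Model

variable {d : ℕ} {Ω : Type*} [MeasurableSpace Ω]

/-- The tail `x ↦ P(B_{j ← i} > x)`. -/
def tail (P : Measure Ω) (B : Fin d → Fin d → Ω → ℕ) (j i : Fin d) (x : ℝ) : ℝ :=
  P.real {ω | x < (B j i ω : ℝ)}

/-- The mean offspring matrix, with entry `E B_{j ← i}` in row `j` and column `i`. -/
def meanMatrix (P : Measure Ω) (B : Fin d → Fin d → Ω → ℕ) : Matrix (Fin d) (Fin d) ℝ :=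
  Matrix.of fun j i => ∫ ω, (B j i ω : ℝ) ∂P

/-- The vectors `s̄_i = E S_i`. -/
def meanS (P : Measure Ω) (S : Fin d → Ω → Fin d → ℝ) (i j : Fin d) : ℝ :=
  ∫ ω, S i ω j ∂P

/-- The distributional fixed-point equation
`S_j = e_j + ∑_i ∑_{m = 1}^{B_{i ← j}} S_i^{(m)}` in law, for all `j`. The right-hand side is
realised on the product of the law of the offspring vector `(B_{i ← j})_i` and the laws of the
independent copies `S_i^{(m)}` of `S_i`. -/
def SolvesFixedPoint (P : Measure Ω) (B : Fin d → Fin d → Ω → ℕ)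
    (S : Fin d → Ω → Fin d → ℝ) : Prop :=
  ∀ j : Fin d,
    P.map (S j) =
      ((P.map (fun ω (i : Fin d) => B i j ω)).prod
        (Measure.infinitePi (fun p : Fin d × ℕ => P.map (S p.1)))).map
          (fun q : (Fin d → ℕ) × (Fin d × ℕ → Fin d → ℝ) =>
            Pi.single j (1 : ℝ) + ∑ i, ∑ m ∈ Finset.range (q.1 i), q.2 (i, m))

/-- The standing assumptions on the offspring counts `B_{j ← i}`, their tail indices `α_{j ← i}`
and the total progeny vectors `S_j`. -/
structure StandingAssumptions (P : Measure Ω) (α : Fin d → Fin d → ℝ)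
    (B : Fin d → Fin d → Ω → ℕ) (S : Fin d → Ω → Fin d → ℝ) : Prop where
  measurable_B : ∀ j i, Measurable (B j i)
  measurable_S : ∀ j, Measurable (S j)
  nonneg_S : ∀ j, ∀ᵐ ω ∂P, S j ω ∈ orthant d
  fixedPoint : SolvesFixedPoint P B S
  /-- Sub-criticality. -/
  subcritical : spectralRadius ℂ ((meanMatrix P B).map (algebraMap ℝ ℂ)) < 1
  /-- Heavy tails in the offspring distribution. -/
  one_lt_index : ∀ j i, 1 < α j i
  regularlyVarying : ∀ j i, RegularlyVarying (tail P B j i) (-α j i)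
  indep : ∀ i, iIndepFun (fun j => B j i) P
  /-- Full connectivity. -/
  connected : ∀ i j, 0 < meanS P S i j
  /-- Exclusion of critical cases. -/
  distinct : ∀ p q : Fin d × Fin d, p ≠ q → α p.1 p.2 ≠ α q.1 q.2

end Model

/-! ### Rate functions and limiting measures -/

/-- The rate function `λ_𝐣(n) = n⁻¹ ∏_{i ∈ 𝐣} n P(B_{i ← l*(i)} > n)`. -/
def rate {d : ℕ} [NeZero d] {Ω : Type*} [MeasurableSpace Ω] (P : Measure Ω)
    (α : Fin d → Fin d → ℝ) (B : Fin d → Fin d → Ω → ℕ) (J : Finset (Fin d)) (n : ℕ) : ℝ :=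
  (n : ℝ)⁻¹ * ∏ i ∈ J, ((n : ℝ) * tail P B i (lStar α i) n)

/-- A type `𝐈 = (I_{k,j})`, given by its depth and by the sets `level k = {j | I_{k+1,j} = 1}` of
active indices at depth `k + 1`: the level is nonempty exactly below the depth, each index is
active at most once, and at most one index is active at the first level. -/
structure ClusterType (d : ℕ) where
  depth : ℕ
  level : ℕ → Finset (Fin d)
  nonempty_iff : ∀ k, (level k).Nonempty ↔ k < depth
  disjoint : ∀ k k', k ≠ k' → Disjoint (level k) (level k')
  card_first : (level 0).card ≤ 1

/-- The set of active indices of a type. -/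
def ClusterType.active {d : ℕ} (I : ClusterType d) : Finset (Fin d) :=
  (Finset.range I.depth).biUnion I.level

/-- The power-law measure `β w^{-β-1} dw` on `(0, ∞)`. -/
def powerLaw (β : ℝ) : Measure ℝ :=
  (volume.restrict (Set.Ioi 0)).withDensity (fun w => ENNReal.ofReal (β / w ^ (β + 1)))

open Classical in
/-- The assignments of `J` to `I`: families of pairwise disjoint subsets of `J`, indexed by `I`,
whose union is `J`. -/
def assignments {d : ℕ} (I J : Finset (Fin d)) : Finset (I → Finset (Fin d)) :=
  Finset.univ.filter fun T =>
    (∀ i, T i ⊆ J) ∧ Finset.univ.biUnion T = J ∧ ∀ i i', i ≠ i' → Disjoint (T i) (T i')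

/-- The function `g_{I ← J}(w)`. -/
def gFun {d : ℕ} [NeZero d] (α s : Fin d → Fin d → ℝ) (I J : Finset (Fin d)) (w : I → ℝ) : ℝ :=
  ∑ T ∈ assignments I J, ∏ i : I, ∏ j ∈ T i, w i * s i (lStar α j)

/-- The product measure `ν^𝐈` of power laws, in the variables `w_{k,j}` with `j` active at
depth `k`. -/
def typeMeasure {d : ℕ} [NeZero d] (α : Fin d → Fin d → ℝ) (I : ClusterType d) :
    Measure ((k : Fin I.depth) → (I.level k → ℝ)) :=
  Measure.pi fun _ => Measure.pi fun j => powerLaw (alphaStar α j)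

/-- The measure `𝐂_i^𝐈`. For a type with active indices, the first level is a singleton `{j₁}`, so
that the first product is the factor `s̄_{i, l*(j₁)}`. -/
def typeLimit {d : ℕ} [NeZero d] (α s : Fin d → Fin d → ℝ) (i : Fin d) (I : ClusterType d) :
    Measure (Fin d → ℝ) :=
  ((typeMeasure α I).withDensity fun w => ENNReal.ofReal
      ((∏ j ∈ I.level 0, s i (lStar α j)) *
        ∏ k : Fin I.depth,
          if (k : ℕ) + 1 < I.depth then gFun α s (I.level k) (I.level (k + 1)) (w k) else 1)).map
    fun w => ∑ k : Fin I.depth, ∑ j : I.level k, w k j • s j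

/-- The limiting measure `∑_{𝐈 : 𝐣^𝐈 = 𝐣} 𝐂_i^𝐈`. -/
def limitMeasure {d : ℕ} [NeZero d] (α s : Fin d → Fin d → ℝ) (i : Fin d) (J : Finset (Fin d)) :
    Measure (Fin d → ℝ) :=
  Measure.sum fun I : {I : ClusterType d // I.active = J} => typeLimit α s i I.1

/-! ### Tail asymptotics -/

section Asymptotics

variable {d : ℕ} {Ω : Type*} [MeasurableSpace Ω]

/-- `P(n⁻¹ S_i ∈ A)`. -/
def scaledProb (P : Measure Ω) (S : Fin d → Ω → Fin d → ℝ) (i : Fin d) (A : Set (Fin d → ℝ))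
    (n : ℕ) : ℝ≥0∞ :=
  P {ω | (n : ℝ)⁻¹ • S i ω ∈ A}

/-- The asymptotics
`𝐂_i^𝐣(A°) ≤ liminf P(n⁻¹ S_i ∈ A) / λ_𝐣(n) ≤ limsup P(n⁻¹ S_i ∈ A) / λ_𝐣(n) ≤ 𝐂_i^𝐣(A⁻) < ∞`,
where `𝐂_i^𝐣` is the sum of the measures `𝐂_i^𝐈` over the types with active indices `𝐣`. -/
def TailAsymptotics [NeZero d] (P : Measure Ω) (α : Fin d → Fin d → ℝ)
    (B : Fin d → Fin d → Ω → ℕ) (S : Fin d → Ω → Fin d → ℝ) (i : Fin d) (J : Finset (Fin d))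
    (A : Set (Fin d → ℝ)) : Prop :=
  limitMeasure α (meanS P S) i J (orthantInterior A)
      ≤ liminf (fun n : ℕ => scaledProb P S i A n / ENNReal.ofReal (rate P α B J n)) atTop ∧
    liminf (fun n : ℕ => scaledProb P S i A n / ENNReal.ofReal (rate P α B J n)) atTop
      ≤ limsup (fun n : ℕ => scaledProb P S i A n / ENNReal.ofReal (rate P α B J n)) atTop ∧
    limsup (fun n : ℕ => scaledProb P S i A n / ENNReal.ofReal (rate P α B J n)) atTop
      ≤ limitMeasure α (meanS P S) i J (closure A) ∧
    limitMeasure α (meanS P S) i J (closure A) < ∞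

end Asymptotics

/-- The Cartesian (`ε = 0`) version, in dimension `d`, of the tail asymptotics theorem: under the
standing assumptions, the tail asymptotics hold for every Borel set `A ⊆ ℝ^d_+` that is merely
bounded away from the union of the cones `ℝ^d(𝐣')` over `𝐣' ≠ 𝐣` with `α(𝐣') ≤ α(𝐣)`. -/
def CartesianTailTheorem (d : ℕ) [NeZero d] : Prop :=
  ∀ (Ω : Type) [MeasurableSpace Ω] (P : Measure Ω) [IsProbabilityMeasure P]
    (α : Fin d → Fin d → ℝ) (B : Fin d → Fin d → Ω → ℕ) (S : Fin d → Ω → Fin d → ℝ),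
    StandingAssumptions P α B S →
    ∀ (i : Fin d) (J : Finset (Fin d)), J.Nonempty →
    ∀ A : Set (Fin d → ℝ), MeasurableSet A → A ⊆ orthant d →
      BoundedAway A (coneLe (meanS P S) (tailIndex α) J 0) →
      TailAsymptotics P α B S i J A

/-! ### The sets of the example (`d = 2`; the types `1, 2` are the indices `0, 1`) -/

/-- The points of `ℝ²_+` at vertical distance more than `r` from the ray generated by `v`. -/
def offRayVertical (v : Fin 2 → ℝ) (r : ℝ) : Set (Fin 2 → ℝ) :=
  {x | x ∈ orthant 2 ∧ ∃ w : ℝ, 0 ≤ w ∧ x 0 = w * v 0 ∧ r < |x 1 - w * v 1|}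

/-- The points of `ℝ²_+` at `L¹` distance more than `r` from the ray generated by `v`. -/
def offRay (v : Fin 2 → ℝ) (r : ℝ) : Set (Fin 2 → ℝ) :=
  {x | x ∈ orthant 2 ∧ r < ⨅ w : Set.Ici (0 : ℝ), l1 (x - (w : ℝ) • v)}

end BranchingTail

end

open BranchingTail

/-!
The set `A` is, up to the value of a constant `ρ > 0`, the set `tubeCompl v ρ` of points `x` of the
quadrant with `ρ < |cross v x|`, where `v` is the mean vector of the first type and `cross v x` is
the determinant of `(v, x)`. A sum of `N` independent copies of `S_1` follows the ray of `v` only up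
to fluctuations of order `√N`. So if the root has of the order of `n²` children of its own type and
none of the other type, the total progeny misses the tube of width `n` with probability bounded
below. The price of this event is of order `n ^ (-2 α*(1))`, whereas leaving the tube by one large
offspring count of the second type costs `n ^ (-α*(2))`, which is less likely as
`2 α*(1) < α*(2)`.

The fluctuations are bounded below with no assumption on second moments. The characteristic
function of a non-constant variable satisfies `|φ(t)|² ≤ 1 - κ t²` near the origin
(`exists_sq_norm_charFun_le`), hence that of a sum of `N` copies is bounded away from `1` in modulus
at `t = 1 / √N`, and this excludes that the sum is mostly of order less than `√N`
(`exists_sqrt_anticoncentration`). The deviation `cross v S_1` is centred, and it is not almost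
surely zero, because without children of the second type it is `- v 1` plus a sum of deviations of
copies (`StandingAssumptions.not_ae_cross_S_eq`). Together with the fixed-point equation this gives
`StandingAssumptions.exists_le_deviation`.

The remaining assertions are planar geometry, and the evaluation of the limiting measure: the only
type with active set `{2}` has depth one, so that measure is the image of a power law on the ray
of the second mean vector (`limitMeasure_singleton_apply`). This ray leaves the tube, since the
first-moment identity prevents the mean vectors from being parallel
(`StandingAssumptions.cross_meanS_ne_zero`).

For the failure of the general assertion a model has to be exhibited. The total progeny is built as
a supremum over generations on a space of independent offspring arrays indexed by the words of the
Ulam–Harris tree, and the branching property `measurePreserving_graft` of that space yields the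
fixed-point equation. Discrete Pareto offspring counts with tails `(m + 2) ^ (-α)` have means at
most `1/4` when `α ≥ 3`, so the mean total progeny is finite (`standingAssumptions_pareto`).
-/

namespace BranchingTail


/-! ### Anticoncentration of sums of independent variables -/

/-- `|φ(t)|²` is the characteristic function of the symmetrisation `X - X'`. -/
lemma sq_norm_charFun_eq_integral_cos (μ : Measure ℝ) [IsProbabilityMeasure μ] (t : ℝ) :
    ‖charFun μ t‖ ^ 2 = ∫ p : ℝ × ℝ, Real.cos (t * (p.1 - p.2)) ∂(μ.prod μ) := by
  have hc : Integrable (fun x => Real.cos (t * x)) μ :=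
    Integrable.of_bound (by fun_prop) 1 (ae_of_all _ fun x => Real.abs_cos_le_one _)
  have hs : Integrable (fun x => Real.sin (t * x)) μ :=
    Integrable.of_bound (by fun_prop) 1 (ae_of_all _ fun x => Real.abs_sin_le_one _)
  have hφ : Integrable (fun x : ℝ => Complex.exp (t * x * Complex.I)) μ := by
    refine Integrable.of_bound (by fun_prop) 1 (ae_of_all _ fun x => ?_)
    rw [← Complex.ofReal_mul, Complex.norm_exp_ofReal_mul_I]
  have hre : (charFun μ t).re = ∫ x, Real.cos (t * x) ∂μ := by
    rw [charFun_apply_real]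
    have := integral_re hφ
    simp only [RCLike.re_to_complex] at this
    rw [← this]
    congr 1 with x
    rw [← Complex.ofReal_mul, Complex.exp_ofReal_mul_I_re]
  have him : (charFun μ t).im = ∫ x, Real.sin (t * x) ∂μ := by
    rw [charFun_apply_real]
    have := integral_im hφ
    simp only [RCLike.im_to_complex] at this
    rw [← this]
    congr 1 with x
    rw [← Complex.ofReal_mul, Complex.exp_ofReal_mul_I_im]
  rw [← Complex.normSq_eq_norm_sq, Complex.normSq_apply, hre, him, ← integral_prod_mul,
    ← integral_prod_mul, ← integral_add (hc.mul_prod hc) (hs.mul_prod hs)]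
  congr 1 with p
  rw [mul_sub, Real.cos_sub]

/-- Two independent copies of a non-constant random variable differ, by an amount bounded away
from `0` and `∞`, with positive probability. -/
lemma exists_prod_sub_mem_Icc_pos (μ : Measure ℝ) [IsProbabilityMeasure μ]
    (hμ : ∀ c, ¬ ∀ᵐ x ∂μ, x = c) :
    ∃ m M : ℝ, 0 < m ∧ 0 < M ∧ 0 < (μ.prod μ).real {p | m ≤ |p.1 - p.2| ∧ |p.1 - p.2| ≤ M} := by
  by_contra! hcon
  have hnull : ∀ k : ℕ, (μ.prod μ)
      {p | 1 / ((k : ℝ) + 1) ≤ |p.1 - p.2| ∧ |p.1 - p.2| ≤ (k : ℝ) + 1} = 0 := by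
    intro k
    have h0 := hcon (1 / ((k : ℝ) + 1)) ((k : ℝ) + 1) (by positivity) (by positivity)
    exact (measureReal_eq_zero_iff).1 (le_antisymm h0 measureReal_nonneg)
  have hae : ∀ᵐ p ∂(μ.prod μ), p.1 = p.2 := by
    refine measure_mono_null ?_ (measure_iUnion_null hnull)
    intro p hp
    have hp' : 0 < |p.1 - p.2| := abs_pos.2 (sub_ne_zero.2 hp)
    obtain ⟨k₁, hk₁⟩ := exists_nat_one_div_lt hp'
    obtain ⟨k₂, hk₂⟩ := exists_nat_gt |p.1 - p.2|
    simp only [Set.mem_iUnion, Set.mem_ofPred_eq]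
    refine ⟨max k₁ k₂, (le_trans ?_ hk₁.le), hk₂.le.trans ?_⟩
    · apply one_div_le_one_div_of_le (by positivity)
      have : (k₁ : ℝ) ≤ (max k₁ k₂ : ℕ) := by exact_mod_cast le_max_left _ _
      linarith
    · have : (k₂ : ℝ) ≤ (max k₁ k₂ : ℕ) := by exact_mod_cast le_max_right _ _
      linarith
  have h2 := Measure.ae_ae_of_ae_prod hae
  obtain ⟨x, hx⟩ := h2.exists
  exact hμ x (hx.mono fun y hy => hy.symm)

/-- The characteristic function of a non-constant random variable decays at least
quadratically at the origin, whether or not the variable has moments. -/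
lemma exists_sq_norm_charFun_le (μ : Measure ℝ) [IsProbabilityMeasure μ]
    (hμ : ∀ c, ¬ ∀ᵐ x ∂μ, x = c) :
    ∃ κ t₀ : ℝ, 0 < κ ∧ 0 < t₀ ∧ ∀ t : ℝ, |t| ≤ t₀ → ‖charFun μ t‖ ^ 2 ≤ 1 - κ * t ^ 2 := by
  obtain ⟨m, M, hm, hM, hpos⟩ := exists_prod_sub_mem_Icc_pos μ hμ
  set E := {p : ℝ × ℝ | m ≤ |p.1 - p.2| ∧ |p.1 - p.2| ≤ M} with hE
  have hEm : MeasurableSet E := by measurability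
  have hπ := Real.pi_pos
  refine ⟨(μ.prod μ).real E * (2 / Real.pi ^ 2 * m ^ 2), Real.pi / M, by positivity,
    by positivity, fun t ht => ?_⟩
  rw [sq_norm_charFun_eq_integral_cos]
  calc ∫ p : ℝ × ℝ, Real.cos (t * (p.1 - p.2)) ∂(μ.prod μ)
      ≤ ∫ p : ℝ × ℝ, (1 - E.indicator (fun _ => 2 / Real.pi ^ 2 * m ^ 2 * t ^ 2) p)
          ∂(μ.prod μ) := by
        refine integral_mono
          (Integrable.of_bound (by fun_prop) 1 (ae_of_all _ fun x => Real.abs_cos_le_one _))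
          ((integrable_const _).sub ((integrable_const _).indicator hEm)) fun p => ?_
        by_cases hp : p ∈ E
        · simp only [Set.indicator_of_mem hp]
          refine (Real.cos_le_one_sub_mul_cos_sq ?_).trans ?_
          · rw [abs_mul]
            calc |t| * |p.1 - p.2| ≤ Real.pi / M * M := by
                  gcongr
                  exact hp.2
              _ = Real.pi := by field_simp
          · have : m ^ 2 * t ^ 2 ≤ (t * (p.1 - p.2)) ^ 2 := by
              rw [mul_pow, mul_comm, ← sq_abs (p.1 - p.2)]
              gcongr
              exact hp.1
            have h3 : 0 < 2 / Real.pi ^ 2 := by positivity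
            nlinarith
        · simp only [Set.indicator_of_notMem hp, sub_zero]
          exact Real.cos_le_one _
    _ = 1 - (μ.prod μ).real E * (2 / Real.pi ^ 2 * m ^ 2) * t ^ 2 := by
        rw [integral_sub (integrable_const _) ((integrable_const _).indicator hEm),
          integral_indicator_const _ hEm]
        simp
        ring

/-- A sum of `N` independent copies of a non-constant variable, shifted by any constant,
exceeds a fixed multiple of `√N` in absolute value with probability bounded away from zero. The
law `ρ` of the shifted sum enters only through the modulus of its characteristic function. -/
lemma exists_sqrt_anticoncentration (μ : Measure ℝ) [IsProbabilityMeasure μ]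
    (hμ : ∀ c, ¬ ∀ᵐ x ∂μ, x = c) :
    ∃ δ c : ℝ, ∃ N₀ : ℕ, 0 < δ ∧ 0 < c ∧ ∀ N : ℕ, N₀ ≤ N → ∀ ρ : Measure ℝ,
      IsProbabilityMeasure ρ → (∀ t, ‖charFun ρ t‖ = ‖charFun μ t‖ ^ N) →
        c ≤ ρ.real {x | δ * √N < |x|} := by
  obtain ⟨κ, t₀, hκ, ht₀, hφ⟩ := exists_sq_norm_charFun_le μ hμ
  set η := Real.exp (-κ / 2) with hη
  have hη0 : 0 < η := Real.exp_pos _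
  have hη1 : η < 1 := by rw [hη, Real.exp_lt_one_iff]; linarith
  obtain ⟨N₁, hN₁⟩ := exists_nat_gt (1 / t₀ ^ 2)
  refine ⟨√(1 - η), (1 - η) / (3 + η), N₁ + 1, Real.sqrt_pos.2 (by linarith),
    div_pos (by linarith) (by linarith), fun N hN ρ _ hρ => ?_⟩
  have hN0 : (0 : ℝ) < N := by
    have : 0 < N := by omega
    exact_mod_cast this
  have hsN : 0 < √(N : ℝ) := Real.sqrt_pos.2 hN0
  have hsq : √(N : ℝ) ^ 2 = N := Real.sq_sqrt hN0.le
  set s := 1 / √(N : ℝ) with hs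
  have hs2 : s ^ 2 = 1 / N := by rw [hs, div_pow, hsq, one_pow]
  have hs0 : 0 < s := by positivity
  -- upper bound on the characteristic function of the sum at `1 / √N`
  have hup : ‖charFun ρ s‖ ≤ η := by
    have h1 : |s| ≤ t₀ := by
      rw [abs_of_pos hs0]
      refine le_of_sq_le_sq ?_ ht₀.le
      rw [hs2, div_le_iff₀ hN0, ← div_le_iff₀' (by positivity)]
      have : (N₁ : ℝ) ≤ N := by exact_mod_cast (by omega : N₁ ≤ N)
      linarith
    have h2 := hφ s h1
    have h3 : ‖charFun μ s‖ ^ 2 ≤ Real.exp (-(κ / N)) := by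
      refine h2.trans ?_
      rw [hs2]
      have := Real.add_one_le_exp (-(κ / N))
      calc 1 - κ * (1 / (N : ℝ)) = -(κ / N) + 1 := by ring
        _ ≤ _ := this
    rw [hρ]
    refine le_of_sq_le_sq ?_ hη0.le
    calc (‖charFun μ s‖ ^ N) ^ 2 = (‖charFun μ s‖ ^ 2) ^ N := by ring
      _ ≤ (Real.exp (-(κ / N))) ^ N := by gcongr
      _ = η ^ 2 := by
        rw [← Real.exp_nat_mul, hη, ← Real.exp_nat_mul]
        congr 1
        push_cast
        field_simp
  set G := {x : ℝ | √(1 - η) * √(N : ℝ) < |x|} with hG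
  have hGm : MeasurableSet G := measurableSet_lt (by fun_prop) (by fun_prop)
  -- lower bound on its real part when the sum is concentrated near zero
  have hlow : (1 + η) / 2 - (3 + η) / 2 * ρ.real G ≤ ‖charFun ρ s‖ := by
    have hint : Integrable (fun x : ℝ => Complex.exp (s * x * Complex.I)) ρ := by
      refine Integrable.of_bound (by fun_prop) 1 (ae_of_all _ fun x => ?_)
      rw [← Complex.ofReal_mul, Complex.norm_exp_ofReal_mul_I]
    have hre : (charFun ρ s).re = ∫ x, Real.cos (s * x) ∂ρ := by
      rw [charFun_apply_real]
      have := integral_re hint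
      simp only [RCLike.re_to_complex] at this
      rw [← this]
      congr 1 with x
      rw [← Complex.ofReal_mul, Complex.exp_ofReal_mul_I_re]
    refine le_trans ?_ (Complex.re_le_norm _)
    rw [hre]
    calc (1 + η) / 2 - (3 + η) / 2 * ρ.real G
        = ∫ x, ((1 + η) / 2 - G.indicator (fun _ => (3 + η) / 2) x) ∂ρ := by
          rw [integral_sub (integrable_const _) ((integrable_const _).indicator hGm),
            integral_indicator_const _ hGm]
          simp
          ring
      _ ≤ _ := by
          refine integral_mono ((integrable_const _).sub ((integrable_const _).indicator hGm))
            (Integrable.of_bound (by fun_prop) 1 (ae_of_all _ fun x => Real.abs_cos_le_one _))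
            fun x => ?_
          by_cases hx : x ∈ G
          · simp only [Set.indicator_of_mem hx]
            have := Real.neg_one_le_cos (s * x)
            linarith
          · simp only [Set.indicator_of_notMem hx, sub_zero]
            have hx' : |x| ≤ √(1 - η) * √(N : ℝ) := not_lt.1 hx
            have h4 : (s * x) ^ 2 ≤ 1 - η := by
              rw [mul_pow, hs2, ← sq_abs x]
              calc 1 / (N : ℝ) * |x| ^ 2 ≤ 1 / N * (√(1 - η) * √(N : ℝ)) ^ 2 := by gcongr
                _ = 1 - η := by
                  rw [mul_pow, hsq, Real.sq_sqrt (by linarith)]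
                  field_simp
            have := Real.one_sub_sq_div_two_le_cos (x := s * x)
            linarith
  rw [div_le_iff₀ (by linarith)]
  linarith


/-! ### Random sums and the distributional fixed-point equation -/

lemma measurable_sum_range {A M : Type*} [MeasurableSpace A] [MeasurableSpace M]
    [AddCommMonoid M] [MeasurableAdd₂ M] {N : A → ℕ} (hN : Measurable N) {f : ℕ → A → M}
    (hf : ∀ m, Measurable (f m)) : Measurable fun a => ∑ m ∈ Finset.range (N a), f m a := by
  have h : Measurable fun p : ℕ × A => ∑ m ∈ Finset.range p.1, f m p.2 :=
    measurable_from_prod_countable_right fun n =>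
      Finset.measurable_fun_sum (Finset.range n) fun m _ => hf m
  exact h.comp (hN.prodMk measurable_id)

/-- Wald's identity for a sum of identically distributed terms whose number is independent of
them. -/
lemma lintegral_sum_range_prod {A ι X : Type*} [MeasurableSpace A] [MeasurableSpace X]
    (ν : Measure A) [SFinite ν] (μ : ι → Measure X) [∀ i, IsProbabilityMeasure (μ i)] {N : A → ℕ}
    (hN : Measurable N) (p : ℕ → ι) {f : X → ℝ≥0∞} (hf : Measurable f) {κ : ℝ≥0∞}
    (hκ : ∀ m, ∫⁻ x, f x ∂μ (p m) = κ) :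
    ∫⁻ z, ∑ m ∈ Finset.range (N z.1), f (z.2 (p m)) ∂(ν.prod (Measure.infinitePi μ))
      = (∫⁻ a, (N a : ℝ≥0∞) ∂ν) * κ := by
  have hmeas : Measurable fun z : A × (ι → X) => ∑ m ∈ Finset.range (N z.1), f (z.2 (p m)) :=
    measurable_sum_range (hN.comp measurable_fst) fun m => by fun_prop
  rw [lintegral_prod _ hmeas.aemeasurable, ← lintegral_mul_const _ (by fun_prop)]
  refine lintegral_congr fun a => ?_
  simp only []
  rw [lintegral_finsetSum _ fun m _ => by fun_prop]
  have h1 : ∀ m, ∫⁻ q : ι → X, f (q (p m)) ∂(Measure.infinitePi μ) = κ := fun m => by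
    rw [← hκ m]
    exact (measurePreserving_eval_infinitePi μ (p m)).lintegral_comp hf
  simp [h1]

/-- The right-hand side of the fixed-point equation, as a function of the offspring vector `q.1`
of the root and of the copies `q.2 (i, m)`. -/
def offspringSum {d : ℕ} (j : Fin d) (q : (Fin d → ℕ) × (Fin d × ℕ → Fin d → ℝ)) : Fin d → ℝ :=
  Pi.single j (1 : ℝ) + ∑ i, ∑ m ∈ Finset.range (q.1 i), q.2 (i, m)

lemma measurable_offspringSum {d : ℕ} (j : Fin d) : Measurable (offspringSum j) := by
  refine measurable_const.add (Finset.measurable_fun_sum _ fun i _ => ?_)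
  exact measurable_sum_range (by fun_prop) fun m => by fun_prop

lemma offspringSum_apply {d : ℕ} (j k : Fin d)
    (q : (Fin d → ℕ) × (Fin d × ℕ → Fin d → ℝ)) :
    offspringSum j q k
      = (Pi.single j (1 : ℝ) : Fin d → ℝ) k + ∑ i, ∑ m ∈ Finset.range (q.1 i), q.2 (i, m) k := by
  simp [offspringSum, Finset.sum_apply]

section FixedPoint

variable {d : ℕ} {Ω : Type*} [MeasurableSpace Ω] {P : Measure Ω}
  {α : Fin d → Fin d → ℝ} {B : Fin d → Fin d → Ω → ℕ} {S : Fin d → Ω → Fin d → ℝ}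

namespace StandingAssumptions

lemma integrable_S (h : StandingAssumptions P α B S) (i j : Fin d) :
    Integrable (fun ω => S i ω j) P := by
  by_contra hc
  have := h.connected i j
  rw [meanS, integral_undef hc] at this
  exact lt_irrefl _ this

lemma lintegral_ofReal_S (h : StandingAssumptions P α B S) (i j : Fin d) :
    ∫⁻ ω, ENNReal.ofReal (S i ω j) ∂P = ENNReal.ofReal (meanS P S i j) :=
  (ofReal_integral_eq_lintegral_ofReal (h.integrable_S i j)
    ((h.nonneg_S i).mono fun _ hω => hω j)).symm

lemma map_S (h : StandingAssumptions P α B S) (j : Fin d) :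
    P.map (S j) = ((P.map (fun ω (i : Fin d) => B i j ω)).prod
        (Measure.infinitePi (fun p : Fin d × ℕ => P.map (S p.1)))).map (offspringSum j) :=
  h.fixedPoint j

/-- The first-moment identity `E S_j = e_j + ∑_i E B_{i ← j} E S_i`, with values in `[0, ∞]`. -/
lemma meanS_eq [IsProbabilityMeasure P] (h : StandingAssumptions P α B S) (j k : Fin d) :
    ENNReal.ofReal (meanS P S j k) = ENNReal.ofReal ((Pi.single j (1 : ℝ) : Fin d → ℝ) k) +
      ∑ i, (∫⁻ ω, (B i j ω : ℝ≥0∞) ∂P) * ENNReal.ofReal (meanS P S i k) := by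
  have hprob : ∀ i, IsProbabilityMeasure (P.map (S i)) := fun i =>
    Measure.isProbabilityMeasure_map (h.measurable_S i).aemeasurable
  have hBm : Measurable (fun ω (i : Fin d) => B i j ω) := by
    have := h.measurable_B
    fun_prop
  have : IsProbabilityMeasure (P.map (fun ω (i : Fin d) => B i j ω)) :=
    Measure.isProbabilityMeasure_map hBm.aemeasurable
  set Q := (P.map (fun ω (i : Fin d) => B i j ω)).prod
        (Measure.infinitePi (fun p : Fin d × ℕ => P.map (S p.1))) with hQ
  have hnn : ∀ᵐ q ∂Q, ∀ p : Fin d × ℕ, 0 ≤ q.2 p k := by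
    rw [ae_all_iff]
    intro p
    have h1 : ∀ᵐ x ∂(P.map (S p.1)), 0 ≤ x k :=
      (ae_map_iff (h.measurable_S p.1).aemeasurable
        (measurableSet_le measurable_const (by fun_prop))).2
        ((h.nonneg_S p.1).mono fun _ hω => hω k)
    have h2 := (measurePreserving_eval_infinitePi
      (fun p : Fin d × ℕ => P.map (S p.1)) p).quasiMeasurePreserving.ae h1
    exact Measure.quasiMeasurePreserving_snd.ae h2
  rw [← h.lintegral_ofReal_S j k]
  have e1 : ∫⁻ ω, ENNReal.ofReal (S j ω k) ∂P
      = ∫⁻ x, ENNReal.ofReal (x k) ∂(P.map (S j)) :=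
    (lintegral_map (f := fun x : Fin d → ℝ => ENNReal.ofReal (x k)) (by fun_prop)
      (h.measurable_S j)).symm
  rw [e1, h.map_S j, ← hQ, lintegral_map (by fun_prop) (measurable_offspringSum j)]
  have e2 : ∫⁻ q, ENNReal.ofReal (offspringSum j q k) ∂Q
      = ∫⁻ q, (ENNReal.ofReal ((Pi.single j (1 : ℝ) : Fin d → ℝ) k) +
          ∑ i, ∑ m ∈ Finset.range (q.1 i), ENNReal.ofReal (q.2 (i, m) k)) ∂Q := by
    refine lintegral_congr_ae (hnn.mono fun q hq => ?_)
    have hs : 0 ≤ (Pi.single j (1 : ℝ) : Fin d → ℝ) k := by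
      rcases eq_or_ne k j with rfl | hkj <;> simp [*]
    simp only []
    rw [offspringSum_apply, ENNReal.ofReal_add hs
      (Finset.sum_nonneg fun i _ => Finset.sum_nonneg fun m _ => hq (i, m)),
      ENNReal.ofReal_sum_of_nonneg fun i _ => Finset.sum_nonneg fun m _ => hq (i, m)]
    congr 1
    refine Finset.sum_congr rfl fun i _ => ?_
    rw [ENNReal.ofReal_sum_of_nonneg fun m _ => hq (i, m)]
  have hm : ∀ i : Fin d, Measurable fun q : (Fin d → ℕ) × (Fin d × ℕ → Fin d → ℝ) =>
      ∑ m ∈ Finset.range (q.1 i), ENNReal.ofReal (q.2 (i, m) k) := fun i =>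
    measurable_sum_range (by fun_prop) fun m => by fun_prop
  rw [e2, lintegral_add_left measurable_const, lintegral_finsetSum _ fun i _ => hm i]
  congr 1
  · simp
  · refine Finset.sum_congr rfl fun i _ => ?_
    have := lintegral_sum_range_prod (P.map (fun ω (i : Fin d) => B i j ω))
      (fun p : Fin d × ℕ => P.map (S p.1)) (N := fun a => a i) (by fun_prop) (fun m => (i, m))
      (f := fun x : Fin d → ℝ => ENNReal.ofReal (x k)) (by fun_prop)
      (κ := ENNReal.ofReal (meanS P S i k)) fun m => by
        rw [lintegral_map (by fun_prop) (h.measurable_S i), h.lintegral_ofReal_S]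
    rw [hQ, this, lintegral_map (by fun_prop) hBm]

end StandingAssumptions

end FixedPoint


/-! ### Planar geometry: complements of tubes around a ray -/

/-- The determinant of `(v, x)`: a linear form in `x` that vanishes exactly on the line through
`v ≠ 0`. -/
def cross (v x : Fin 2 → ℝ) : ℝ := v 0 * x 1 - v 1 * x 0

lemma measurable_cross (v : Fin 2 → ℝ) : Measurable (cross v) := by
  unfold cross
  fun_prop

lemma continuous_cross (v : Fin 2 → ℝ) : Continuous (cross v) := by
  unfold cross
  fun_prop

lemma cross_smul (v x : Fin 2 → ℝ) (c : ℝ) : cross v (c • x) = c * cross v x := by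
  simp only [cross, Pi.smul_apply, smul_eq_mul]
  ring

lemma cross_self_smul (v : Fin 2 → ℝ) (c : ℝ) : cross v (c • v) = 0 := by
  simp only [cross, Pi.smul_apply, smul_eq_mul]
  ring

lemma cross_add (v x y : Fin 2 → ℝ) : cross v (x + y) = cross v x + cross v y := by
  simp only [cross, Pi.add_apply]
  ring

lemma cross_sub (v x y : Fin 2 → ℝ) : cross v (x - y) = cross v x - cross v y := by
  simp only [cross, Pi.sub_apply]
  ring

lemma cross_sum {ι : Type*} (v : Fin 2 → ℝ) (s : Finset ι) (f : ι → Fin 2 → ℝ) :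
    cross v (∑ i ∈ s, f i) = ∑ i ∈ s, cross v (f i) := by
  simp only [cross, Finset.sum_apply, Finset.mul_sum, Finset.sum_sub_distrib]

lemma l1_two (x : Fin 2 → ℝ) : l1 x = |x 0| + |x 1| := by simp [l1]

lemma abs_cross_le {v : Fin 2 → ℝ} (h0 : 0 ≤ v 0) (h1 : 0 ≤ v 1) (x : Fin 2 → ℝ) :
    |cross v x| ≤ max (v 0) (v 1) * l1 x := by
  rw [l1_two, cross]
  calc |v 0 * x 1 - v 1 * x 0| ≤ |v 0 * x 1| + |v 1 * x 0| := abs_sub _ _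
    _ = v 0 * |x 1| + v 1 * |x 0| := by rw [abs_mul, abs_mul, abs_of_nonneg h0, abs_of_nonneg h1]
    _ ≤ max (v 0) (v 1) * |x 1| + max (v 0) (v 1) * |x 0| := by
        gcongr
        · exact le_max_left _ _
        · exact le_max_right _ _
    _ = _ := by ring

/-- The points of the quadrant whose determinant with `v` exceeds `ρ` in absolute value. Both
complements of tubes around the ray of `v` are of this form. -/
def tubeCompl (v : Fin 2 → ℝ) (ρ : ℝ) : Set (Fin 2 → ℝ) :=
  {x | x ∈ orthant 2 ∧ ρ < |cross v x|}

lemma offRayVertical_eq_tubeCompl {v : Fin 2 → ℝ} (h0 : 0 < v 0) (r : ℝ) :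
    offRayVertical v r = tubeCompl v (r * v 0) := by
  ext x
  have key : ∀ w, x 0 = w * v 0 → |cross v x| = |x 1 - w * v 1| * v 0 := fun w hw => by
    rw [← abs_of_pos h0, ← abs_mul, cross, hw]
    congr 1
    ring
  constructor
  · rintro ⟨hx, w, hw, hxw, hr⟩
    refine ⟨hx, ?_⟩
    rw [key w hxw]
    gcongr
  · rintro ⟨hx, hr⟩
    have hxw : x 0 = x 0 / v 0 * v 0 := by field_simp
    refine ⟨hx, x 0 / v 0, div_nonneg (hx 0) h0.le, hxw, ?_⟩
    rw [key _ hxw] at hr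
    exact lt_of_mul_lt_mul_right hr h0.le

lemma offRay_eq_tubeCompl {v : Fin 2 → ℝ} (h0 : 0 < v 0) (h1 : 0 < v 1) (r : ℝ) :
    offRay v r = tubeCompl v (r * max (v 0) (v 1)) := by
  have hmax : 0 < max (v 0) (v 1) := lt_max_of_lt_left h0
  ext x
  have hbdd : BddBelow (Set.range fun w : Set.Ici (0 : ℝ) => l1 (x - (w : ℝ) • v)) :=
    ⟨0, by rintro _ ⟨w, rfl⟩; exact Finset.sum_nonneg fun i _ => abs_nonneg _⟩
  constructor
  · rintro ⟨hx, hr⟩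
    refine ⟨hx, ?_⟩
    -- the distance is attained where the larger coordinate of `v` is matched exactly
    rcases le_total (v 1) (v 0) with hv | hv
    · have h2 := hr.trans_le (ciInf_le hbdd ⟨x 0 / v 0, div_nonneg (hx 0) h0.le⟩)
      have h3 : |cross v x| = |x 1 - x 0 / v 0 * v 1| * v 0 := by
        rw [← abs_of_pos h0, ← abs_mul, abs_of_pos h0, cross]
        congr 1
        field_simp
      rw [max_eq_left hv, h3]
      gcongr
      simpa [l1_two, div_mul_cancel₀ _ h0.ne'] using h2
    · have h2 := hr.trans_le (ciInf_le hbdd ⟨x 1 / v 1, div_nonneg (hx 1) h1.le⟩)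
      have h3 : |cross v x| = |x 0 - x 1 / v 1 * v 0| * v 1 := by
        rw [← abs_of_pos h1, ← abs_mul, abs_of_pos h1, cross, abs_sub_comm]
        congr 1
        field_simp
      rw [max_eq_right hv, h3]
      gcongr
      simpa [l1_two, div_mul_cancel₀ _ h1.ne'] using h2
  · rintro ⟨hx, hr⟩
    refine ⟨hx, ?_⟩
    refine lt_of_lt_of_le ((lt_div_iff₀ hmax).2 hr) (le_ciInf fun w => ?_)
    have h2 := abs_cross_le h0.le h1.le (x - (w : ℝ) • v)
    rw [cross_sub, cross_self_smul, sub_zero] at h2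
    rw [div_le_iff₀' hmax]
    exact h2

lemma measurableSet_orthant (d : ℕ) : MeasurableSet (orthant d) := by
  have : orthant d = ⋂ i, {x | 0 ≤ x i} := by
    ext x
    simp [orthant]
  rw [this]
  exact MeasurableSet.iInter fun i => measurableSet_le measurable_const (measurable_pi_apply i)

lemma measurableSet_tubeCompl (v : Fin 2 → ℝ) (ρ : ℝ) : MeasurableSet (tubeCompl v ρ) :=
  (measurableSet_orthant 2).inter
    (measurableSet_lt measurable_const (continuous_abs.measurable.comp (measurable_cross v)))

lemma tubeCompl_subset_orthantInterior (v : Fin 2 → ℝ) (ρ : ℝ) :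
    tubeCompl v ρ ⊆ orthantInterior (tubeCompl v ρ) := by
  rintro x ⟨hx, hρ⟩
  refine ⟨hx, mem_nhdsWithin.2 ⟨{y | ρ < |cross v y|},
    isOpen_lt continuous_const (continuous_abs.comp (continuous_cross v)), hρ, ?_⟩⟩
  rintro y ⟨h1, h2⟩
  exact ⟨h2, h1⟩

lemma closure_tubeCompl_subset (v : Fin 2 → ℝ) (ρ : ℝ) :
    closure (tubeCompl v ρ) ⊆ {x | ρ ≤ |cross v x|} :=
  closure_minimal (fun _ hx => hx.2.le)
    (isClosed_le continuous_const (continuous_abs.comp (continuous_cross v)))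

lemma cone_singleton {d : ℕ} (s : Fin d → Fin d → ℝ) (i : Fin d) :
    cone s {i} = {x | ∃ w : ℝ, 0 ≤ w ∧ x = w • s i} := by
  ext x
  simp only [cone, Finset.sum_singleton, Set.mem_ofPred_eq]
  constructor
  · rintro ⟨w, hw, rfl⟩
    exact ⟨w i, hw i, rfl⟩
  · rintro ⟨w, hw, rfl⟩
    exact ⟨fun _ => w, fun _ => hw, rfl⟩

lemma l1_smul {d : ℕ} (c : ℝ) (x : Fin d → ℝ) : l1 (c • x) = |c| * l1 x := by
  simp [l1, abs_mul, Finset.mul_sum]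

lemma l1_nonneg {d : ℕ} (x : Fin d → ℝ) : 0 ≤ l1 x := Finset.sum_nonneg fun _ _ => abs_nonneg _

lemma eq_zero_of_l1_eq_zero {d : ℕ} {x : Fin d → ℝ} (h : l1 x = 0) : x = 0 := by
  ext i
  exact abs_eq_zero.1 ((Finset.sum_eq_zero_iff_of_nonneg fun _ _ => abs_nonneg _).1 h i
    (Finset.mem_univ i))

/-- The unit vector in the direction of a vector of the orthant. -/
lemma inv_l1_smul_mem {d : ℕ} {s : Fin d → Fin d → ℝ} {i : Fin d} (hi : s i ∈ orthant d)
    (hpos : 0 < l1 (s i)) : (l1 (s i))⁻¹ • s i ∈ cone s {i} ∩ unitSphere d := by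
  refine ⟨?_, fun k => ?_, ?_⟩
  · rw [cone_singleton]
    exact ⟨_, (inv_pos.2 hpos).le, rfl⟩
  · exact mul_nonneg (inv_pos.2 hpos).le (hi k)
  · rw [l1_smul, abs_of_pos (inv_pos.2 hpos), inv_mul_cancel₀ hpos.ne']

lemma cone_inter_unitSphere_subset {d : ℕ} {s : Fin d → Fin d → ℝ} {i : Fin d} :
    cone s {i} ∩ unitSphere d ⊆ {(l1 (s i))⁻¹ • s i} := by
  rintro x ⟨hx, -, hx1⟩
  rw [cone_singleton] at hx
  obtain ⟨w, hw, rfl⟩ := hx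
  rw [l1_smul, abs_of_nonneg hw] at hx1
  rw [Set.mem_singleton_iff, eq_inv_of_mul_eq_one_left hx1]

lemma enlargedCone_singleton {d : ℕ} {s : Fin d → Fin d → ℝ} {i : Fin d} (hi : s i ∈ orthant d)
    (hpos : 0 < l1 (s i)) (ε : ℝ) :
    enlargedCone s {i} ε = {x | ∃ w : ℝ, 0 ≤ w ∧ ∃ θ ∈ unitSphere d, x = w • θ ∧
      ENNReal.ofReal (l1 (θ - (l1 (s i))⁻¹ • s i)) ≤ ENNReal.ofReal ε} := by
  have hset : cone s {i} ∩ unitSphere d = {(l1 (s i))⁻¹ • s i} :=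
    cone_inter_unitSphere_subset.antisymm
      (Set.singleton_subset_iff.2 (inv_l1_smul_mem hi hpos))
  simp only [enlargedCone, hset, Set.mem_singleton_iff, iInf_iInf_eq_left]
  simp

lemma enlargedCone_singleton_zero {d : ℕ} {s : Fin d → Fin d → ℝ} {i : Fin d}
    (hi : s i ∈ orthant d) (hpos : 0 < l1 (s i)) : enlargedCone s {i} 0 = cone s {i} := by
  rw [enlargedCone_singleton hi hpos, cone_singleton]
  ext x
  constructor
  · rintro ⟨w, hw, θ, -, rfl, hθ⟩
    have h0 : l1 (θ - (l1 (s i))⁻¹ • s i) = 0 := by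
      have : l1 (θ - (l1 (s i))⁻¹ • s i) ≤ 0 := by simpa using hθ
      exact le_antisymm this (l1_nonneg _)
    rw [sub_eq_zero.1 (eq_zero_of_l1_eq_zero h0)]
    exact ⟨w * (l1 (s i))⁻¹, mul_nonneg hw (inv_pos.2 hpos).le, smul_smul _ _ _⟩
  · rintro ⟨w, hw, rfl⟩
    refine ⟨w * l1 (s i), mul_nonneg hw hpos.le, _, (inv_l1_smul_mem hi hpos).2, ?_, ?_⟩
    · rw [smul_smul, mul_assoc, mul_inv_cancel₀ hpos.ne', mul_one]
    · simp [l1]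

/-- The only sets with tail index at most `α({2})` are `∅` and `{1}`, if `α({1}) ≤ α({2})`. -/
lemma tailIndex_le_iff {α : Fin 2 → Fin 2 → ℝ} (h0 : 1 < alphaStar α 0)
    (h01 : alphaStar α 0 ≤ alphaStar α 1) (J : Finset (Fin 2)) :
    (J ≠ {1} ∧ tailIndex α J ≤ tailIndex α {1}) ↔ J = ∅ ∨ J = {0} := by
  have hu : (Finset.univ : Finset (Finset (Fin 2))) = {∅, {0}, {1}, {0, 1}} := by decide
  have hJ : J ∈ (Finset.univ : Finset (Finset (Fin 2))) := Finset.mem_univ J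
  rw [hu] at hJ
  simp only [Finset.mem_insert, Finset.mem_singleton] at hJ
  have e1 : ({0} : Finset (Fin 2)) ≠ {1} := by decide
  have e2 : (∅ : Finset (Fin 2)) ≠ {1} := by decide
  have e3 : ({0, 1} : Finset (Fin 2)) ≠ {1} := by decide
  have e4 : ({0, 1} : Finset (Fin 2)) ≠ {0} := by decide
  rcases hJ with rfl | rfl | rfl | rfl
  · simp [tailIndex, e2]
    linarith
  · simp [tailIndex, e1]
    linarith
  · simp [e1.symm, e2.symm]
  · simp [tailIndex, e3, e4]
    linarith

lemma coneLe_one {s α : Fin 2 → Fin 2 → ℝ} (h0 : 1 < alphaStar α 0)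
    (h01 : alphaStar α 0 ≤ alphaStar α 1) (ε : ℝ) :
    coneLe s (tailIndex α) {1} ε = {0} ∪ enlargedCone s {0} ε := by
  have e : ({0} : Finset (Fin 2)) ≠ ∅ := by decide
  ext x
  simp only [coneLe, Set.mem_ofPred_eq, ← and_assoc, tailIndex_le_iff h0 h01]
  constructor
  · rintro ⟨J, rfl | rfl, hx⟩
    · left
      simpa [enlargedCone] using hx
    · exact Or.inr hx
  · rintro (hx | hx)
    · exact ⟨∅, Or.inl rfl, by simpa [enlargedCone] using hx⟩
    · exact ⟨{0}, Or.inr rfl, hx⟩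

lemma coneLe_one_zero {s α : Fin 2 → Fin 2 → ℝ} (h0 : 1 < alphaStar α 0)
    (h01 : alphaStar α 0 ≤ alphaStar α 1) (hi : s 0 ∈ orthant 2) (hpos : 0 < l1 (s 0)) :
    coneLe s (tailIndex α) {1} 0 = cone s {0} := by
  rw [coneLe_one h0 h01, enlargedCone_singleton_zero hi hpos]
  refine Set.union_eq_self_of_subset_left (Set.singleton_subset_iff.2 ?_)
  rw [cone_singleton]
  exact ⟨0, le_rfl, (zero_smul _ _).symm⟩

lemma boundedAway_tubeCompl {s : Fin 2 → Fin 2 → ℝ} (h0 : 0 < s 0 0) (h1 : 0 < s 0 1) {ρ : ℝ}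
    (hρ : 0 < ρ) : BoundedAway (tubeCompl (s 0) ρ) (cone s {0}) := by
  have hmax : 0 < max (s 0 0) (s 0 1) := lt_max_of_lt_left h0
  refine ⟨ρ / max (s 0 0) (s 0 1), div_pos hρ hmax, fun x hx y hy => ?_⟩
  rw [cone_singleton] at hy
  obtain ⟨w, -, rfl⟩ := hy
  have h2 := abs_cross_le h0.le h1.le (x - w • s 0)
  rw [cross_sub, cross_self_smul, sub_zero] at h2
  rw [div_le_iff₀' hmax]
  exact hx.2.le.trans h2

/-- An angular enlargement of the ray, however small, eventually leaves every tube around it. -/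
lemma not_boundedAway_tubeCompl {s : Fin 2 → Fin 2 → ℝ} (h0 : 0 < s 0 0) (h1 : 0 < s 0 1)
    {ρ ε : ℝ} (hε : 0 < ε) :
    ¬ ∃ r : ℝ, 0 < r ∧ ∀ x ∈ tubeCompl (s 0) ρ, ∀ y ∈ enlargedCone s {0} ε, r ≤ l1 (x - y) := by
  rintro ⟨r, hr, hA⟩
  have hi : s 0 ∈ orthant 2 := fun k => by fin_cases k <;> simp [h0.le, h1.le]
  have hl : l1 (s 0) = s 0 0 + s 0 1 := by rw [l1_two, abs_of_pos h0, abs_of_pos h1]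
  have hpos : 0 < l1 (s 0) := by rw [hl]; positivity
  -- tilt the direction of the ray by `t` towards the first axis
  set t := min 1 (ε / 2) with ht
  have ht0 : 0 < t := lt_min one_pos (by positivity)
  have ht1 : t ≤ 1 := min_le_left _ _
  have htε : 2 * t ≤ ε := by have := min_le_right 1 (ε / 2); linarith
  set θ : Fin 2 → ℝ := ![(1 - t) * (s 0 0 / l1 (s 0)) + t, (1 - t) * (s 0 1 / l1 (s 0))] with hθ
  have hθ0 : 0 ≤ θ 0 := by
    simp only [hθ, Matrix.cons_val_zero]
    have : 0 ≤ 1 - t := by linarith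
    positivity
  have hθ1 : 0 ≤ θ 1 := by
    simp only [hθ, Matrix.cons_val_one, Matrix.cons_val_fin_one]
    have : 0 ≤ 1 - t := by linarith
    positivity
  have hθo : θ ∈ orthant 2 := fun k => by fin_cases k <;> assumption
  have hsum : s 0 0 / l1 (s 0) + s 0 1 / l1 (s 0) = 1 := by
    rw [← add_div, ← hl, div_self hpos.ne']
  have hθs : θ ∈ unitSphere 2 := by
    refine ⟨hθo, ?_⟩
    rw [l1_two, abs_of_nonneg hθ0, abs_of_nonneg hθ1]
    simp only [hθ, Matrix.cons_val_zero, Matrix.cons_val_one, Matrix.cons_val_fin_one]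
    linear_combination (1 - t) * hsum
  have hcross : cross (s 0) θ = -(t * s 0 1) := by
    simp only [cross, hθ, Matrix.cons_val_zero, Matrix.cons_val_one, Matrix.cons_val_fin_one]
    field_simp
    ring
  have hdist : l1 (θ - (l1 (s 0))⁻¹ • s 0) ≤ ε := by
    have q0 : s 0 0 / l1 (s 0) ≤ 1 := by
      have : 0 ≤ s 0 1 / l1 (s 0) := by positivity
      linarith
    have q1 : 0 ≤ s 0 1 / l1 (s 0) := by positivity
    have e0 : (θ - (l1 (s 0))⁻¹ • s 0) 0 = t * (1 - s 0 0 / l1 (s 0)) := by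
      simp only [hθ, Pi.sub_apply, Pi.smul_apply, smul_eq_mul, Matrix.cons_val_zero]
      field_simp
      ring
    have e1 : (θ - (l1 (s 0))⁻¹ • s 0) 1 = -(t * (s 0 1 / l1 (s 0))) := by
      simp only [hθ, Pi.sub_apply, Pi.smul_apply, smul_eq_mul, Matrix.cons_val_one,
        Matrix.cons_val_fin_one]
      field_simp
      ring
    rw [l1_two, e0, e1, abs_neg, abs_of_nonneg (mul_nonneg ht0.le (by linarith)),
      abs_of_nonneg (mul_nonneg ht0.le q1)]
    have q2 : t * (s 0 1 / l1 (s 0)) ≤ t :=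
      mul_le_of_le_one_right ht0.le (by linarith [div_nonneg h0.le hpos.le])
    have q3 : 1 - s 0 0 / l1 (s 0) = s 0 1 / l1 (s 0) := by linarith
    rw [q3]
    linarith
  obtain ⟨w, hw⟩ := exists_gt (max 0 (ρ / (t * s 0 1)))
  have hw0 : 0 < w := (le_max_left _ _).trans_lt hw
  have hwρ : ρ / (t * s 0 1) < w := (le_max_right _ _).trans_lt hw
  have hmem : w • θ ∈ tubeCompl (s 0) ρ := by
    refine ⟨fun k => mul_nonneg hw0.le (hθo k), ?_⟩
    rw [cross_smul, hcross, abs_mul, abs_neg, abs_of_pos hw0, abs_of_pos (by positivity)]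
    rwa [div_lt_iff₀ (by positivity)] at hwρ
  have hmem' : w • θ ∈ enlargedCone s {0} ε := by
    rw [enlargedCone_singleton hi hpos]
    exact ⟨w, hw0.le, θ, hθs, rfl, ENNReal.ofReal_le_ofReal hdist⟩
  have := hA _ hmem _ hmem'
  simp [l1] at this
  linarith


/-! ### The limiting measure of a single index -/

lemma powerLaw_Ici_lt_top {β t : ℝ} (hβ : 0 < β) (ht : 0 < t) :
    powerLaw β (Set.Ici t) < ∞ := by
  rw [powerLaw, withDensity_apply _ measurableSet_Ici, Measure.restrict_restrict measurableSet_Ici]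
  have hI : IntegrableOn (fun w : ℝ => β * w ^ (-(β + 1))) (Set.Ici t) := by
    rw [integrableOn_Ici_iff_integrableOn_Ioi]
    exact (integrableOn_Ioi_rpow_of_lt (by linarith) ht).const_mul β
  refine lt_of_le_of_lt (lintegral_mono_set Set.inter_subset_left) ?_
  refine lt_of_eq_of_lt (setLIntegral_congr_fun measurableSet_Ici fun w hw => ?_)
    hI.lintegral_lt_top
  have hw0 : 0 ≤ w := ht.le.trans hw
  simp only [Real.rpow_neg hw0, div_eq_mul_inv]

lemma powerLaw_Ioi_pos {β t : ℝ} (hβ : 0 < β) (ht : 0 < t) : 0 < powerLaw β (Set.Ioi t) := by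
  have hsub : Set.Ioi t ⊆ Set.Ioi (0 : ℝ) := Set.Ioi_subset_Ioi ht.le
  rw [powerLaw, withDensity_apply _ measurableSet_Ioi, Measure.restrict_restrict measurableSet_Ioi,
    Set.inter_eq_left.2 hsub, setLIntegral_pos_iff (by fun_prop)]
  have : Set.Ioi t ⊆ Function.support (fun w : ℝ => ENNReal.ofReal (β / w ^ (β + 1))) := by
    intro w hw
    have hw0 : 0 < w := ht.trans hw
    have : 0 < β / w ^ (β + 1) := div_pos hβ (Real.rpow_pos_of_pos hw0 _)
    simpa using this
  rw [Set.inter_eq_right.2 this]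
  simp

/-- The type of depth one whose only active index is `j`. -/
def singletonType {d : ℕ} (j : Fin d) : ClusterType d where
  depth := 1
  level k := if k = 0 then {j} else ∅
  nonempty_iff k := by
    by_cases hk : k = 0 <;> simp [hk]
  disjoint k k' h := by
    by_cases hk : k = 0
    · have : k' ≠ 0 := fun h' => h (hk.trans h'.symm)
      simp [this]
    · simp [hk]
  card_first := by simp

lemma eq_singletonType {d : ℕ} {j : Fin d} {I : ClusterType d} (hI : I.active = {j}) :
    I = singletonType j := by
  have hlev : ∀ k < I.depth, I.level k = {j} := fun k hk => by
    have hsub : I.level k ⊆ {j} := by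
      rw [← hI]
      exact Finset.subset_biUnion_of_mem I.level (Finset.mem_range.2 hk)
    exact (Finset.subset_singleton_iff.1 hsub).resolve_left ((I.nonempty_iff k).2 hk).ne_empty
  have hlev' : ∀ k, ¬ k < I.depth → I.level k = ∅ := fun k hk =>
    Finset.not_nonempty_iff_eq_empty.1 fun h => hk ((I.nonempty_iff k).1 h)
  have hd0 : I.depth ≠ 0 := fun h0 => by
    have : j ∈ I.active := by rw [hI]; exact Finset.mem_singleton_self j
    simp [ClusterType.active, h0] at this
  have hd1 : ¬ 1 < I.depth := fun h1 => by
    have := I.disjoint 0 1 (by norm_num)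
    rw [hlev 0 (by omega), hlev 1 h1] at this
    simp at this
  have hd : I.depth = 1 := by omega
  have hl : I.level = fun k => if k = 0 then {j} else ∅ := by
    ext1 k
    by_cases hk : k = 0
    · rw [if_pos hk, hlev k (by omega)]
    · rw [if_neg hk, hlev' k (by omega)]
  cases I
  simp only at hd hl
  subst hd hl
  rfl

lemma active_singletonType {d : ℕ} (j : Fin d) : (singletonType j).active = {j} := by
  simp [ClusterType.active, singletonType]

lemma limitMeasure_singleton {d : ℕ} [NeZero d] (α s : Fin d → Fin d → ℝ) (i j : Fin d) :
    limitMeasure α s i {j} = typeLimit α s i (singletonType j) := by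
  ext T hT
  rw [limitMeasure, Measure.sum_apply _ hT,
    tsum_eq_single ⟨singletonType j, active_singletonType j⟩]
  rintro ⟨I, hI⟩ hne
  exact absurd (Subtype.ext (eq_singletonType hI)) hne

instance (β : ℝ) : SigmaFinite (powerLaw β) := by
  unfold powerLaw
  infer_instance

/-- The limiting measure of a single index `j` is carried by the ray of `s j`, and is a multiple
of a power law in the radial variable. -/
lemma limitMeasure_singleton_apply {d : ℕ} [NeZero d] (α s : Fin d → Fin d → ℝ) (i j : Fin d)
    {T : Set (Fin d → ℝ)} (hT : MeasurableSet T) :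
    limitMeasure α s i {j} T = ENNReal.ofReal (s i (lStar α j)) *
      powerLaw (alphaStar α j) {w : ℝ | w • s j ∈ T} := by
  have hconst : (fun w : (k : Fin (singletonType j).depth) → ((singletonType j).level k → ℝ) =>
      ENNReal.ofReal ((∏ j' ∈ (singletonType j).level 0, s i (lStar α j')) *
        ∏ k : Fin (singletonType j).depth,
          if (k : ℕ) + 1 < (singletonType j).depth then
            gFun α s ((singletonType j).level k) ((singletonType j).level (k + 1)) (w k) else 1))
      = fun _ => ENNReal.ofReal (s i (lStar α j)) := by
    ext w
    simp [singletonType]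
  have hmeas : Measurable
      (fun w : (k : Fin (singletonType j).depth) → ((singletonType j).level k → ℝ) =>
        ∑ k : Fin (singletonType j).depth, ∑ j' : (singletonType j).level k, w k j' • s j') := by
    refine Finset.measurable_fun_sum _ fun k _ => Finset.measurable_fun_sum _ fun j' _ => ?_
    exact Measurable.smul_const ((measurable_pi_apply j').comp (measurable_pi_apply k)) _
  rw [limitMeasure_singleton, typeLimit, hconst, withDensity_const, Measure.map_smul,
    Measure.smul_apply, smul_eq_mul, Measure.map_apply hmeas hT]
  congr 1
  let _ : Unique (Fin (singletonType j).depth) := inferInstanceAs (Unique (Fin 1))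
  have hlev : ∀ k : Fin (singletonType j).depth, (singletonType j).level k = {j} := fun k => by
    have hk : (k : ℕ) = 0 := Nat.lt_one_iff.1 k.2
    simp [singletonType, hk]
  let _ : ∀ k : Fin (singletonType j).depth, Unique ((singletonType j).level k) := fun k =>
    { default := ⟨j, by simp [hlev k]⟩
      uniq := fun j' => Subtype.ext (Finset.mem_singleton.1 ((Finset.ext_iff.1 (hlev k) j').1 j'.2)) }
  have hdef : ∀ k : Fin (singletonType j).depth,
      ((default : (singletonType j).level k) : Fin d) = j := fun _ => rfl
  have hpre : (fun w : (k : Fin (singletonType j).depth) → ((singletonType j).level k → ℝ) =>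
        ∑ k : Fin (singletonType j).depth, ∑ j' : (singletonType j).level k, w k j' • s j') ⁻¹' T
      = Set.univ.pi fun _ => Set.univ.pi fun _ => {w : ℝ | w • s j ∈ T} := by
    ext w
    simp only [Set.mem_preimage, Fintype.sum_unique, hdef, Set.mem_univ_pi, Unique.forall_iff,
      Set.mem_ofPred_eq]
  rw [hpre, typeMeasure, Measure.pi_pi]
  simp only [Measure.pi_pi, Fintype.prod_unique, hdef]


/-! ### Deviations from the mean ray caused by one large offspring count -/

section TwoTypes

variable {Ω : Type*} [MeasurableSpace Ω] {P : Measure Ω}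
  {α : Fin 2 → Fin 2 → ℝ} {B : Fin 2 → Fin 2 → Ω → ℕ} {S : Fin 2 → Ω → Fin 2 → ℝ}

/-- If the root has no child of the second type, the deviation of the total progeny from the ray
of `v` is a sum of the deviations over the children of the first type, up to a constant. -/
lemma cross_offspringSum (v : Fin 2 → ℝ) {q : (Fin 2 → ℕ) × (Fin 2 × ℕ → Fin 2 → ℝ)}
    (hq : q.1 1 = 0) :
    cross v (offspringSum 0 q) = ∑ m ∈ Finset.range (q.1 0), cross v (q.2 (0, m)) + -v 1 := by
  rw [offspringSum, cross_add, Fin.sum_univ_two, hq, Finset.sum_range_zero, add_zero, cross_sum,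
    add_comm]
  simp [cross]

namespace StandingAssumptions

/-- The mean vectors of the two types are not parallel: otherwise the first-moment identity would
make `e_1` parallel to them too. -/
lemma cross_meanS_ne_zero [IsProbabilityMeasure P] (h : StandingAssumptions P α B S) :
    cross (meanS P S 0) (meanS P S 1) ≠ 0 := by
  have hv : ∀ i j, 0 < meanS P S i j := h.connected
  set b : Fin 2 → ℝ≥0∞ := fun i => ∫⁻ ω, (B i 0 ω : ℝ≥0∞) ∂P with hb
  have e0 := h.meanS_eq 0 0
  have e1 := h.meanS_eq 0 1
  simp only [Fin.sum_univ_two, Pi.single_eq_same, ENNReal.ofReal_one, ne_eq, one_ne_zero,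
    not_false_eq_true, Pi.single_eq_of_ne, ENNReal.ofReal_zero, zero_add] at e0 e1
  have hfin : ∀ i, b i ≠ ∞ := fun i hi => by
    have hne : b 0 * ENNReal.ofReal (meanS P S 0 1) + b 1 * ENNReal.ofReal (meanS P S 1 1) ≠ ∞ :=
      e1 ▸ ENNReal.ofReal_ne_top
    fin_cases i
    · exact hne (by
        simp only [Fin.zero_eta] at hi
        rw [hi, ENNReal.top_mul (by simpa using hv 0 1), top_add])
    · exact hne (by
        simp only [Fin.mk_one] at hi
        rw [hi, ENNReal.top_mul (by simpa using hv 1 1), add_top])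
  have hterm : ∀ i k, b i * ENNReal.ofReal (meanS P S i k) ≠ ∞ := fun i k =>
    ENNReal.mul_ne_top (hfin i) ENNReal.ofReal_ne_top
  have r0 : meanS P S 0 0
      = 1 + ((b 0).toReal * meanS P S 0 0 + (b 1).toReal * meanS P S 1 0) := by
    have := congrArg ENNReal.toReal e0
    rw [ENNReal.toReal_add ENNReal.one_ne_top (ENNReal.add_ne_top.2 ⟨hterm 0 0, hterm 1 0⟩),
      ENNReal.toReal_add (hterm 0 0) (hterm 1 0), ENNReal.toReal_mul, ENNReal.toReal_mul,
      ENNReal.toReal_ofReal (hv 0 0).le, ENNReal.toReal_ofReal (hv 1 0).le,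
      ENNReal.toReal_one] at this
    exact this
  have r1 : meanS P S 0 1 = (b 0).toReal * meanS P S 0 1 + (b 1).toReal * meanS P S 1 1 := by
    have := congrArg ENNReal.toReal e1
    rw [ENNReal.toReal_add (hterm 0 1) (hterm 1 1), ENNReal.toReal_mul, ENNReal.toReal_mul,
      ENNReal.toReal_ofReal (hv 0 1).le, ENNReal.toReal_ofReal (hv 1 1).le] at this
    exact this
  intro hc
  rw [cross] at hc
  have := hv 0 1
  have : meanS P S 0 1 = 0 := by
    linear_combination (-meanS P S 0 1) * r0 + meanS P S 0 0 * r1 + (b 1).toReal * hc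
  linarith

lemma measurable_cross_S (h : StandingAssumptions P α B S) (v : Fin 2 → ℝ) :
    Measurable fun ω => cross v (S 0 ω) :=
  (measurable_cross v).comp (h.measurable_S 0)

/-- The deviation of `S_1` from its mean ray is centred, and it is not constant: otherwise it would
vanish, contradicting the recursion on the event that the root has no child of type two. -/
lemma not_ae_cross_S_eq [IsProbabilityMeasure P] (h : StandingAssumptions P α B S)
    (hB : 0 < P {ω | B 1 0 ω = 0}) (c : ℝ) :
    ¬ ∀ᵐ ω ∂P, cross (meanS P S 0) (S 0 ω) = c := by
  intro hc
  set v := meanS P S 0 with hv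
  have hv1 : 0 < v 1 := h.connected 0 1
  have hprob : ∀ i, IsProbabilityMeasure (P.map (S i)) := fun i =>
    Measure.isProbabilityMeasure_map (h.measurable_S i).aemeasurable
  have hmean : ∫ ω, cross v (S 0 ω) ∂P = 0 := by
    simp only [cross]
    rw [integral_sub ((h.integrable_S 0 1).const_mul _) ((h.integrable_S 0 0).const_mul _),
      integral_const_mul, integral_const_mul]
    change v 0 * v 1 - v 1 * v 0 = 0
    ring
  have hc0 : c = 0 := by
    rw [integral_congr_ae hc] at hmean
    simpa using hmean
  subst hc0
  have hBm : Measurable (fun ω (i : Fin 2) => B i 0 ω) := by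
    have := h.measurable_B
    fun_prop
  have : IsProbabilityMeasure (P.map (fun ω (i : Fin 2) => B i 0 ω)) :=
    Measure.isProbabilityMeasure_map hBm.aemeasurable
  have hcm : MeasurableSet {x : Fin 2 → ℝ | cross v x = 0} :=
    measurableSet_eq_fun (measurable_cross v) measurable_const
  have hlaw : ∀ᵐ x ∂(P.map (S 0)), cross v x = 0 :=
    (ae_map_iff (h.measurable_S 0).aemeasurable hcm).2 hc
  set Q := (P.map (fun ω (i : Fin 2) => B i 0 ω)).prod
        (Measure.infinitePi (fun p : Fin 2 × ℕ => P.map (S p.1))) with hQ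
  have h1 : ∀ᵐ q ∂Q, cross v (offspringSum 0 q) = 0 := by
    rw [h.map_S 0, ae_map_iff (measurable_offspringSum 0).aemeasurable hcm] at hlaw
    exact hlaw
  have h2 : ∀ᵐ q ∂Q, ∀ m : ℕ, cross v (q.2 (0, m)) = 0 := by
    rw [ae_all_iff]
    intro m
    have := (measurePreserving_eval_infinitePi
      (fun p : Fin 2 × ℕ => P.map (S p.1)) (0, m)).quasiMeasurePreserving.ae hlaw
    exact Measure.quasiMeasurePreserving_snd.ae this
  have h3 : ∀ᵐ q ∂Q, q.1 1 ≠ 0 := by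
    filter_upwards [h1, h2] with q hq1 hq2 hq
    rw [cross_offspringSum v hq, Finset.sum_eq_zero fun m _ => hq2 m] at hq1
    linarith
  have h4 : Q {q | q.1 1 = 0} = P {ω | B 1 0 ω = 0} := by
    have hset : {q : (Fin 2 → ℕ) × (Fin 2 × ℕ → Fin 2 → ℝ) | q.1 1 = 0}
        = {a | a 1 = 0} ×ˢ Set.univ := by
      ext q
      simp
    rw [hset, hQ, Measure.prod_prod, measure_univ, mul_one,
      Measure.map_apply hBm (measurableSet_eq_fun (by fun_prop) (by fun_prop))]
    rfl
  have h5 : Q {q | q.1 1 = 0} = 0 := by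
    rw [← nonpos_iff_eq_zero]
    refine (measure_mono fun q hq => ?_).trans (ae_iff.1 h3).le
    simpa using hq
  rw [h4] at h5
  exact hB.ne' h5

/-- With `N` children of the first type and none of the second, the deviation from the mean ray has
the order of `√N` with probability bounded below. -/
lemma exists_le_infinitePi_deviation [IsProbabilityMeasure P] (h : StandingAssumptions P α B S)
    (hB : 0 < P {ω | B 1 0 ω = 0}) :
    ∃ δ c : ℝ, ∃ N₀ : ℕ, 0 < δ ∧ 0 < c ∧ ∀ a : Fin 2 → ℕ, N₀ ≤ a 0 → a 1 = 0 →
      ENNReal.ofReal c ≤ Measure.infinitePi (fun p : Fin 2 × ℕ => P.map (S p.1))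
        {q | δ * √(a 0 : ℝ) < |cross (meanS P S 0) (offspringSum 0 (a, q))|} := by
  set v := meanS P S 0 with hv
  have hprob : ∀ i, IsProbabilityMeasure (P.map (S i)) := fun i =>
    Measure.isProbabilityMeasure_map (h.measurable_S i).aemeasurable
  set μ := P.map (fun ω => cross v (S 0 ω)) with hμ
  have hμp : IsProbabilityMeasure μ :=
    Measure.isProbabilityMeasure_map (h.measurable_cross_S v).aemeasurable
  have hnd : ∀ c, ¬ ∀ᵐ x ∂μ, x = c := fun c hc =>
    h.not_ae_cross_S_eq hB c (ae_of_ae_map (h.measurable_cross_S v).aemeasurable hc)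
  obtain ⟨δ, c, N₀, hδ, hc, hN₀⟩ := exists_sqrt_anticoncentration μ hnd
  refine ⟨δ, c, N₀, hδ, hc, fun a ha0 ha1 => ?_⟩
  set R := Measure.infinitePi (fun p : Fin 2 × ℕ => P.map (S p.1)) with hR
  set X : ℕ → (Fin 2 × ℕ → Fin 2 → ℝ) → ℝ := fun m q => cross v (q (0, m)) with hX
  have hXm : ∀ m, Measurable (X m) := fun m => (measurable_cross v).comp (measurable_pi_apply _)
  have hind : iIndepFun X R :=
    (iIndepFun_infinitePi (P := fun p : Fin 2 × ℕ => P.map (S p.1))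
      (X := fun _ x => cross v x) fun _ => measurable_cross v).precomp
        (g := fun m : ℕ => ((0 : Fin 2), m)) (Prod.mk_right_injective 0)
  have hlaw : ∀ m, R.map (X m) = μ := fun m => by
    have h1 := (measurePreserving_eval_infinitePi
      (fun p : Fin 2 × ℕ => P.map (S p.1)) (0, m)).map_eq
    have h2 : X m = cross v ∘ Function.eval ((0 : Fin 2), m) := rfl
    rw [h2, ← Measure.map_map (measurable_cross v) (measurable_pi_apply _), h1,
      Measure.map_map (measurable_cross v) (h.measurable_S 0)]
    rfl
  have hsm : Measurable fun q => ∑ m ∈ Finset.range (a 0), X m q :=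
    Finset.measurable_fun_sum _ fun m _ => hXm m
  set ρ := (R.map fun q => ∑ m ∈ Finset.range (a 0), X m q).map (· + -v 1) with hρ
  have hρ' : ρ = R.map fun q => cross v (offspringSum 0 (a, q)) := by
    rw [hρ, Measure.map_map (by fun_prop) hsm]
    congr 1 with q
    exact (cross_offspringSum v (q := (a, q)) ha1).symm
  have hφ : ∀ t, ‖charFun ρ t‖ = ‖charFun μ t‖ ^ a 0 := fun t => by
    rw [hρ, charFun_map_add_const, iIndepFun.charFun_map_fun_finsetSum_eq_prod
      (fun m _ => (hXm m).aemeasurable) (hind.restrict _), norm_mul, Complex.norm_exp_ofReal_mul_I,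
      mul_one]
    simp [hlaw]
  have hρp : IsProbabilityMeasure ρ := by
    have : IsProbabilityMeasure (R.map fun q => ∑ m ∈ Finset.range (a 0), X m q) :=
      Measure.isProbabilityMeasure_map hsm.aemeasurable
    exact Measure.isProbabilityMeasure_map (by fun_prop)
  have hfin := hN₀ (a 0) ha0 ρ hρp hφ
  have hsetm : MeasurableSet {x : ℝ | δ * √(a 0 : ℝ) < |x|} :=
    measurableSet_lt (by fun_prop) (by fun_prop)
  rw [← ENNReal.ofReal_toReal (measure_ne_top R _)]
  refine ENNReal.ofReal_le_ofReal (hfin.trans_eq ?_)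
  rw [hρ', Measure.real, Measure.map_apply ?_ hsetm]
  · rfl
  · exact (measurable_cross v).comp ((measurable_offspringSum 0).comp measurable_prodMk_left)

/-- A number of children of type one of the order `n²` makes the total progeny deviate from its
mean ray by the order `n`, with probability bounded below. -/
lemma exists_le_deviation [IsProbabilityMeasure P] (h : StandingAssumptions P α B S)
    (hB : 0 < P {ω | B 1 0 ω = 0}) {ρ : ℝ} (hρ : 0 < ρ) :
    ∃ K : ℝ, ∃ c : ℝ≥0∞, 0 < K ∧ 0 < c ∧ ∀ᶠ n : ℕ in atTop,
      c * P {ω | K * (n : ℝ) ^ 2 < B 0 0 ω} ≤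
        P {ω | ρ * n < |cross (meanS P S 0) (S 0 ω)|} := by
  obtain ⟨δ, c, N₀, hδ, hc, hN₀⟩ := h.exists_le_infinitePi_deviation hB
  set v := meanS P S 0 with hv
  have hprob : ∀ i, IsProbabilityMeasure (P.map (S i)) := fun i =>
    Measure.isProbabilityMeasure_map (h.measurable_S i).aemeasurable
  have hBm : Measurable (fun ω (i : Fin 2) => B i 0 ω) := by
    have := h.measurable_B
    fun_prop
  have : IsProbabilityMeasure (P.map (fun ω (i : Fin 2) => B i 0 ω)) :=
    Measure.isProbabilityMeasure_map hBm.aemeasurable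
  -- the choice of `K` makes `δ √N` exceed `ρ n` as soon as `N > K n²`
  refine ⟨(ρ / δ) ^ 2, ENNReal.ofReal c * P {ω | B 1 0 ω = 0}, by positivity,
    ENNReal.mul_pos (by simpa using hc) hB.ne', ?_⟩
  have hlim : Tendsto (fun n : ℕ => (ρ / δ) ^ 2 * (n : ℝ) ^ 2) atTop atTop :=
    ((tendsto_pow_atTop two_ne_zero).comp tendsto_natCast_atTop_atTop).const_mul_atTop
      (by positivity)
  filter_upwards [hlim.eventually_ge_atTop (N₀ : ℝ)] with n hn
  set E : Set (Fin 2 → ℕ) := {a | (ρ / δ) ^ 2 * (n : ℝ) ^ 2 < a 0} ∩ {a | a 1 = 0} with hE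
  have hEm : MeasurableSet E := by
    refine MeasurableSet.inter (measurableSet_lt measurable_const ?_) ?_
    · exact (measurable_from_top (f := fun k : ℕ => (k : ℝ))).comp (measurable_pi_apply 0)
    · exact measurableSet_eq_fun (measurable_pi_apply 1) measurable_const
  have hEP : P.map (fun ω (i : Fin 2) => B i 0 ω) E
      = P {ω | (ρ / δ) ^ 2 * (n : ℝ) ^ 2 < B 0 0 ω} * P {ω | B 1 0 ω = 0} := by
    rw [Measure.map_apply hBm hEm]
    have hi : IndepFun (B 0 0) (B 1 0) P := (h.indep 0).indepFun (by decide)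
    exact hi.measure_inter_preimage_eq_mul {k : ℕ | (ρ / δ) ^ 2 * (n : ℝ) ^ 2 < k} {k | k = 0}
      (MeasurableSet.of_discrete) (MeasurableSet.of_discrete)
  have hGm : MeasurableSet {x : Fin 2 → ℝ | ρ * n < |cross v x|} :=
    measurableSet_lt measurable_const (continuous_abs.measurable.comp (measurable_cross v))
  have e1 : P {ω | ρ * n < |cross v (S 0 ω)|}
      = P.map (S 0) {x | ρ * n < |cross v x|} := by
    rw [Measure.map_apply (h.measurable_S 0) hGm]
    rfl
  rw [e1, h.map_S 0, Measure.map_apply (measurable_offspringSum 0) hGm,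
    Measure.prod_apply (measurable_offspringSum 0 hGm)]
  calc ENNReal.ofReal c * P {ω | B 1 0 ω = 0} * P {ω | (ρ / δ) ^ 2 * (n : ℝ) ^ 2 < B 0 0 ω}
      = ∫⁻ _ in E, ENNReal.ofReal c ∂(P.map (fun ω (i : Fin 2) => B i 0 ω)) := by
        rw [setLIntegral_const, hEP, mul_assoc, mul_comm (P {ω | B 1 0 ω = 0})]
    _ ≤ ∫⁻ a in E, Measure.infinitePi (fun p : Fin 2 × ℕ => P.map (S p.1))
          (Prod.mk a ⁻¹' (offspringSum 0 ⁻¹' {x | ρ * n < |cross v x|}))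
          ∂(P.map (fun ω (i : Fin 2) => B i 0 ω)) := by
        refine setLIntegral_mono' hEm fun a ha => ?_
        have ha0 : (ρ / δ) ^ 2 * (n : ℝ) ^ 2 < a 0 := ha.1
        have hN : N₀ ≤ a 0 := by exact_mod_cast hn.trans ha0.le
        refine (hN₀ a hN ha.2).trans (measure_mono fun q hq => ?_)
        refine lt_of_le_of_lt ?_ (show δ * √(a 0 : ℝ) < |cross v (offspringSum 0 (a, q))| from hq)
        calc ρ * n = δ * √((ρ / δ) ^ 2 * (n : ℝ) ^ 2) := by
              rw [← mul_pow, Real.sqrt_sq (by positivity)]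
              field_simp
          _ ≤ δ * √(a 0 : ℝ) := by gcongr
    _ ≤ _ := setLIntegral_le_lintegral _ _

end StandingAssumptions

end TwoTypes


/-! ### Failure of the predicted asymptotics -/

lemma alphaStar_eq_lStar {d : ℕ} [NeZero d] (α : Fin d → Fin d → ℝ) (j : Fin d) :
    alphaStar α j = α j (lStar α j) := by
  have h : ∀ l, α j (lStar α j) ≤ α j l := (Finite.exists_min (α j)).choose_spec
  exact le_antisymm (Finset.inf'_le _ (Finset.mem_univ _)) (Finset.le_inf' _ _ fun l _ => h l)

lemma alphaStar_zero_eq {α : Fin 2 → Fin 2 → ℝ} (h : α 0 0 < α 0 1) : alphaStar α 0 = α 0 0 := by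
  refine le_antisymm (Finset.inf'_le _ (Finset.mem_univ _)) (Finset.le_inf' _ _ fun l _ => ?_)
  fin_cases l
  · exact le_rfl
  · exact h.le

lemma lt_alphaStar_one {α : Fin 2 → Fin 2 → ℝ} {x : ℝ} (h0 : x < α 1 0) (h1 : x < α 1 1) :
    x < alphaStar α 1 := by
  refine (Finset.lt_inf'_iff _).2 fun l _ => ?_
  fin_cases l <;> assumption

section

variable {Ω : Type*} [MeasurableSpace Ω] {P : Measure Ω}

lemma tendsto_rpow_mul_rate {d : ℕ} [NeZero d] {α : Fin d → Fin d → ℝ}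
    {B : Fin d → Fin d → Ω → ℕ} {j : Fin d} {κ : ℝ}
    (h : Tendsto (fun x : ℝ => tail P B j (lStar α j) x * x ^ α j (lStar α j)) atTop (𝓝 κ)) :
    Tendsto (fun n : ℕ => (n : ℝ) ^ alphaStar α j * rate P α B {j} n) atTop (𝓝 κ) := by
  refine (h.comp tendsto_natCast_atTop_atTop).congr' ?_
  filter_upwards [eventually_ge_atTop 1] with n hn
  have hn0 : (n : ℝ) ≠ 0 := by positivity
  simp only [Function.comp_apply, rate, Finset.prod_singleton, alphaStar_eq_lStar]
  field_simp

variable {α : Fin 2 → Fin 2 → ℝ} {B : Fin 2 → Fin 2 → Ω → ℕ} {S : Fin 2 → Ω → Fin 2 → ℝ}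

namespace StandingAssumptions

lemma deviation_le_scaledProb (h : StandingAssumptions P α B S) (v : Fin 2 → ℝ) (ρ : ℝ) {n : ℕ}
    (hn : 1 ≤ n) :
    P {ω | ρ * n < |cross v (S 0 ω)|} ≤ scaledProb P S 0 (tubeCompl v ρ) n := by
  have hn0 : (0 : ℝ) < n := by exact_mod_cast hn
  refine measure_mono_ae ?_
  filter_upwards [h.nonneg_S 0] with ω hω hdev
  refine ⟨fun k => mul_nonneg (inv_pos.2 hn0).le (hω k), ?_⟩
  rw [cross_smul, abs_mul, abs_of_pos (inv_pos.2 hn0), inv_mul_eq_div, lt_div_iff₀ hn0]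
  exact hdev

/-- The deviation probability is at least of order `n ^ (-2 α_{1 ← 1})`, the order of
`P(B_{1 ← 1} > n²)`. -/
lemma exists_le_rpow_mul_scaledProb [IsProbabilityMeasure P] (h : StandingAssumptions P α B S)
    (hB : 0 < P {ω | B 1 0 ω = 0}) {κ : ℝ} (hκ : 0 < κ)
    (htail : Tendsto (fun x : ℝ => tail P B 0 0 x * x ^ α 0 0) atTop (𝓝 κ)) {ρ : ℝ}
    (hρ : 0 < ρ) :
    ∃ c : ℝ≥0∞, 0 < c ∧ ∀ᶠ n : ℕ in atTop, c ≤
      ENNReal.ofReal ((n : ℝ) ^ (2 * α 0 0)) *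
        scaledProb P S 0 (tubeCompl (meanS P S 0) ρ) n := by
  obtain ⟨K, c, hK, hc, hdev⟩ := h.exists_le_deviation hB hρ
  have hKa : 0 < K ^ α 0 0 := Real.rpow_pos_of_pos hK _
  have hlim : Tendsto (fun n : ℕ => K * (n : ℝ) ^ 2) atTop atTop :=
    ((tendsto_pow_atTop two_ne_zero).comp tendsto_natCast_atTop_atTop).const_mul_atTop hK
  refine ⟨c * ENNReal.ofReal (κ / 2 / K ^ α 0 0),
    ENNReal.mul_pos hc.ne' (by simpa using by positivity), ?_⟩
  filter_upwards [hdev, (htail.comp hlim).eventually_const_le (half_lt_self hκ),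
    eventually_ge_atTop 1] with n h1 h2 h3
  have hn0 : (0 : ℝ) < n := by exact_mod_cast h3
  have hpow : (n : ℝ) ^ (2 * α 0 0) * K ^ α 0 0 = (K * (n : ℝ) ^ 2) ^ α 0 0 := by
    rw [Real.mul_rpow hK.le (by positivity), ← Real.rpow_natCast (n : ℝ) 2, ← Real.rpow_mul hn0.le,
      Nat.cast_ofNat, mul_comm]
  have h4 : κ / 2 / K ^ α 0 0 ≤ (n : ℝ) ^ (2 * α 0 0) * tail P B 0 0 (K * (n : ℝ) ^ 2) := by
    rw [div_le_iff₀ hKa, mul_right_comm, hpow, mul_comm]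
    exact h2
  calc c * ENNReal.ofReal (κ / 2 / K ^ α 0 0)
      ≤ c * ENNReal.ofReal ((n : ℝ) ^ (2 * α 0 0) * tail P B 0 0 (K * (n : ℝ) ^ 2)) := by gcongr
    _ = ENNReal.ofReal ((n : ℝ) ^ (2 * α 0 0)) * (c * P {ω | K * (n : ℝ) ^ 2 < B 0 0 ω}) := by
        rw [ENNReal.ofReal_mul (by positivity), tail, ofReal_measureReal, mul_left_comm]
    _ ≤ _ := by
        gcongr
        exact h1.trans (h.deviation_le_scaledProb _ _ h3)

end StandingAssumptions

lemma tendsto_rpow_mul_top {p : ℕ → ℝ≥0∞} {a b : ℝ} (hab : b < a) {c : ℝ≥0∞} (hc : 0 < c)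
    (hp : ∀ᶠ n : ℕ in atTop, c ≤ ENNReal.ofReal ((n : ℝ) ^ b) * p n) :
    Tendsto (fun n : ℕ => ENNReal.ofReal ((n : ℝ) ^ a) * p n) atTop (𝓝 ∞) := by
  have h1 : Tendsto (fun n : ℕ => ENNReal.ofReal ((n : ℝ) ^ (a - b))) atTop (𝓝 ∞) :=
    ENNReal.tendsto_ofReal_nhds_top.2
      ((tendsto_rpow_atTop (sub_pos.2 hab)).comp tendsto_natCast_atTop_atTop)
  have h2 : Tendsto (fun n : ℕ => ENNReal.ofReal ((n : ℝ) ^ (a - b)) * c) atTop (𝓝 ∞) := by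
    have := ENNReal.Tendsto.mul_const h1 (Or.inl ENNReal.top_ne_zero) (b := c)
    rwa [ENNReal.top_mul hc.ne'] at this
  refine tendsto_nhds_top_mono h2 ?_
  filter_upwards [hp, eventually_ge_atTop 1] with n hn h3
  have hn0 : (0 : ℝ) < n := by exact_mod_cast h3
  calc ENNReal.ofReal ((n : ℝ) ^ (a - b)) * c
      ≤ ENNReal.ofReal ((n : ℝ) ^ (a - b)) * (ENNReal.ofReal ((n : ℝ) ^ b) * p n) := by gcongr
    _ = ENNReal.ofReal ((n : ℝ) ^ a) * p n := by
        rw [← mul_assoc, ← ENNReal.ofReal_mul (by positivity), ← Real.rpow_add hn0,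
          sub_add_cancel]

lemma not_tailAsymptotics_of_tendsto_top {d : ℕ} [NeZero d] {α : Fin d → Fin d → ℝ}
    {B : Fin d → Fin d → Ω → ℕ} {S : Fin d → Ω → Fin d → ℝ} {i : Fin d} {J : Finset (Fin d)}
    {A : Set (Fin d → ℝ)} {a κ : ℝ}
    (hrate : Tendsto (fun n : ℕ => (n : ℝ) ^ a * rate P α B J n) atTop (𝓝 κ))
    (htop : Tendsto (fun n : ℕ => ENNReal.ofReal ((n : ℝ) ^ a) * scaledProb P S i A n) atTop
      (𝓝 ∞)) :
    ¬ TailAsymptotics P α B S i J A := by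
  rintro ⟨-, -, h1, h2⟩
  have hratio : Tendsto (fun n : ℕ => scaledProb P S i A n / ENNReal.ofReal (rate P α B J n))
      atTop (𝓝 ∞) := by
    have h3 := ENNReal.Tendsto.div htop (Or.inl ENNReal.top_ne_zero)
      (ENNReal.tendsto_ofReal hrate) (Or.inl ENNReal.ofReal_ne_top)
    rw [ENNReal.top_div_of_ne_top ENNReal.ofReal_ne_top] at h3
    refine h3.congr' ?_
    filter_upwards [eventually_ge_atTop 1] with n hn
    have hn0 : (0 : ℝ) < n := by exact_mod_cast hn
    have hpos : 0 < (n : ℝ) ^ a := Real.rpow_pos_of_pos hn0 _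
    rw [ENNReal.ofReal_mul hpos.le]
    exact ENNReal.mul_div_mul_left _ _ (by simpa using hpos) ENNReal.ofReal_ne_top
  rw [hratio.limsup_eq] at h1
  exact absurd h2 (not_lt.2 h1)

lemma limitMeasure_orthantInterior_pos {s : Fin 2 → Fin 2 → ℝ} (hs : ∀ i j, 0 < s i j)
    (hcross : cross (s 0) (s 1) ≠ 0) (hα : 0 < alphaStar α 1) {ρ : ℝ} (hρ : 0 < ρ) :
    0 < limitMeasure α s 0 {1} (orthantInterior (tubeCompl (s 0) ρ)) := by
  have hc : 0 < |cross (s 0) (s 1)| := abs_pos.2 hcross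
  refine lt_of_lt_of_le ?_ (measure_mono (tubeCompl_subset_orthantInterior _ _))
  rw [limitMeasure_singleton_apply _ _ _ _ (measurableSet_tubeCompl _ _)]
  refine ENNReal.mul_pos (by simpa using hs _ _) (ne_of_gt ?_)
  refine (powerLaw_Ioi_pos hα (div_pos hρ hc)).trans_le (measure_mono fun w hw => ?_)
  have hw' : ρ / |cross (s 0) (s 1)| < w := hw
  have hw0 : 0 < w := (div_pos hρ hc).trans hw'
  refine ⟨fun k => mul_nonneg hw0.le (hs 1 k).le, ?_⟩
  rw [cross_smul, abs_mul, abs_of_pos hw0]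
  rwa [div_lt_iff₀ hc] at hw'

lemma limitMeasure_closure_lt_top {s : Fin 2 → Fin 2 → ℝ}
    (hcross : cross (s 0) (s 1) ≠ 0) (hα : 0 < alphaStar α 1) {ρ : ℝ} (hρ : 0 < ρ) :
    limitMeasure α s 0 {1} (closure (tubeCompl (s 0) ρ)) < ∞ := by
  have hc : 0 < |cross (s 0) (s 1)| := abs_pos.2 hcross
  rw [limitMeasure_singleton_apply _ _ _ _ isClosed_closure.measurableSet]
  refine ENNReal.mul_lt_top ENNReal.ofReal_lt_top ?_
  -- the power law is carried by `(0, ∞)`, so only positive radii matter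
  have hneg : powerLaw (alphaStar α 1) (Set.Iic 0) = 0 := by
    refine withDensity_absolutelyContinuous _ _ ?_
    rw [Measure.restrict_apply measurableSet_Iic, Set.Iic_inter_Ioi, Set.Ioc_self, measure_empty]
  refine lt_of_le_of_lt (measure_mono fun w hw => ?_)
    (lt_of_le_of_lt (measure_union_le (Set.Iic 0) (Set.Ici (ρ / |cross (s 0) (s 1)|))) ?_)
  · rcases le_or_gt w 0 with hw0 | hw0
    · exact Or.inl hw0
    · right
      have h1 : ρ ≤ |cross (s 0) (w • s 1)| := closure_tubeCompl_subset _ _ hw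
      rw [cross_smul, abs_mul, abs_of_pos hw0] at h1
      exact (div_le_iff₀ hc).2 h1
  · rw [hneg, zero_add]
    exact powerLaw_Ici_lt_top hα (div_pos hρ hc)

lemma tubeCompl_inter_cone_nonempty {s : Fin 2 → Fin 2 → ℝ} (hs : ∀ i j, 0 < s i j)
    (hcross : cross (s 0) (s 1) ≠ 0) (ρ : ℝ) :
    (tubeCompl (s 0) ρ ∩ cone s {1}).Nonempty := by
  have hc : 0 < |cross (s 0) (s 1)| := abs_pos.2 hcross
  obtain ⟨w, hw⟩ := exists_gt (max 0 (ρ / |cross (s 0) (s 1)|))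
  have hw0 : 0 < w := (le_max_left _ _).trans_lt hw
  have hwρ := (le_max_right _ _).trans_lt hw
  refine ⟨w • s 1, ⟨fun k => mul_nonneg hw0.le (hs 1 k).le, ?_⟩, ?_⟩
  · rw [cross_smul, abs_mul, abs_of_pos hw0]
    rwa [div_lt_iff₀ hc] at hwρ
  · rw [cone_singleton]
    exact ⟨w, hw0.le, rfl⟩

theorem two_type_counterexample [IsProbabilityMeasure P] {c : Fin 2 → Fin 2 → ℝ}
    (h : StandingAssumptions P α B S)
    (hc : ∀ j i, 0 < c j i ∧
      Tendsto (fun x : ℝ => tail P B j i x * x ^ α j i) atTop (𝓝 (c j i)))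
    (h2 : 2 < α 0 0) (h01 : α 0 0 < α 0 1) (h10 : 2 * α 0 0 < α 1 0) (h11 : 2 * α 0 0 < α 1 1)
    (hB : 0 < P {ω | B 1 0 ω = 0}) :
    2 < alphaStar α 0 ∧ 2 * alphaStar α 0 < alphaStar α 1 ∧
      ∀ r : ℝ, 0 < r → ∀ A : Set (Fin 2 → ℝ),
        (A = offRayVertical (meanS P S 0) r ∨ A = offRay (meanS P S 0) r) →
        0 < liminf (fun n : ℕ =>
            ENNReal.ofReal ((n : ℝ) ^ (2 * alphaStar α 0)) * scaledProb P S 0 A n) atTop ∧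
        MeasurableSet A ∧ A ⊆ orthant 2 ∧
        coneLe (meanS P S) (tailIndex α) {1} 0 = cone (meanS P S) {0} ∧
        BoundedAway A (coneLe (meanS P S) (tailIndex α) {1} 0) ∧
        (∀ ε : ℝ, 0 < ε → ¬ BoundedAway A (coneLe (meanS P S) (tailIndex α) {1} ε)) ∧
        (A ∩ cone (meanS P S) {1}).Nonempty ∧
        (∃ κ : ℝ, 0 < κ ∧
          Tendsto (fun n : ℕ => (n : ℝ) ^ alphaStar α 1 * rate P α B {1} n) atTop (𝓝 κ)) ∧
        0 < limitMeasure α (meanS P S) 0 {1} (orthantInterior A) ∧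
        limitMeasure α (meanS P S) 0 {1} (closure A) < ∞ ∧
        Tendsto (fun n : ℕ =>
            ENNReal.ofReal ((n : ℝ) ^ alphaStar α 1) * scaledProb P S 0 A n) atTop (𝓝 ∞) ∧
        ¬ TailAsymptotics P α B S 0 {1} A := by
  have ha0 := alphaStar_zero_eq h01
  have ha1 : 2 * alphaStar α 0 < alphaStar α 1 := ha0 ▸ lt_alphaStar_one h10 h11
  have hv : ∀ i j, 0 < meanS P S i j := h.connected
  have hcross := h.cross_meanS_ne_zero
  have ho : meanS P S 0 ∈ orthant 2 := fun k => (hv 0 k).le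
  have hl : 0 < l1 (meanS P S 0) := by
    rw [l1_two, abs_of_pos (hv 0 0), abs_of_pos (hv 0 1)]
    exact add_pos (hv 0 0) (hv 0 1)
  refine ⟨ha0 ▸ h2, ha1, fun r hr A hA => ?_⟩
  obtain ⟨ρ, hρ, rfl⟩ : ∃ ρ : ℝ, 0 < ρ ∧ A = tubeCompl (meanS P S 0) ρ := by
    rcases hA with rfl | rfl
    · exact ⟨_, mul_pos hr (hv 0 0), offRayVertical_eq_tubeCompl (hv 0 0) r⟩
    · exact ⟨_, mul_pos hr (lt_max_of_lt_left (hv 0 0)),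
        offRay_eq_tubeCompl (hv 0 0) (hv 0 1) r⟩
  obtain ⟨b, hb, hlow⟩ := h.exists_le_rpow_mul_scaledProb hB (hc 0 0).1 (hc 0 0).2 hρ
  rw [← ha0] at hlow
  have hcone := coneLe_one_zero (s := meanS P S) (α := α) (by linarith) (by linarith) ho hl
  have hrate := tendsto_rpow_mul_rate (hc 1 (lStar α 1)).2
  have htop := tendsto_rpow_mul_top ha1 hb hlow
  refine ⟨hb.trans_le (le_liminf_of_le (by isBoundedDefault) hlow), measurableSet_tubeCompl _ _,
    fun x hx => hx.1, hcone, ?_, fun ε hε hbd => ?_, tubeCompl_inter_cone_nonempty hv hcross ρ,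
    ⟨_, (hc 1 (lStar α 1)).1, hrate⟩,
    limitMeasure_orthantInterior_pos hv hcross (by linarith) hρ,
    limitMeasure_closure_lt_top hcross (by linarith) hρ, htop,
    not_tailAsymptotics_of_tendsto_top hrate htop⟩
  · rw [hcone]
    exact boundedAway_tubeCompl (hv 0 0) (hv 0 1) hρ
  · rw [coneLe_one (by linarith) (by linarith)] at hbd
    obtain ⟨r', hr', hbd⟩ := hbd
    exact not_boundedAway_tubeCompl (hv 0 0) (hv 0 1) hε
      ⟨r', hr', fun x hx y hy => hbd x hx y (Or.inr hy)⟩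

end


/-! ### Total progeny of a multitype branching process on the Ulam–Harris tree -/

section Tree

variable {d : ℕ}

/-- A realisation of a multitype branching process: individuals are labelled by words in the
letters `(i, m)` (the `m`-th child, of type `i`), read from the root downwards, and the
entry `ω u j i` is the number of type-`j` children that the individual `u` has if its type is
`i`. -/
abbrev Genealogy (d : ℕ) : Type := List (Fin d × ℕ) → Fin d → Fin d → ℕ

/-- The genealogy with offspring array `z.1` at the root and subtree `z.2 p` below the child
`p`. -/
def graft (z : (Fin d → Fin d → ℕ) × (Fin d × ℕ → Genealogy d)) : Genealogy d
  | [] => z.1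
  | p :: u => z.2 p u

lemma measurable_graft : Measurable (graft (d := d)) := by
  refine measurable_pi_lambda _ fun u => ?_
  cases u with
  | nil => exact measurable_fst
  | cons p u => exact (measurable_pi_apply u).comp ((measurable_pi_apply p).comp measurable_snd)

/-- The law of a genealogy with independent offspring arrays of law `ν`. -/
noncomputable def genealogyLaw (ν : Measure (Fin d → Fin d → ℕ)) : Measure (Genealogy d) :=
  Measure.infinitePi fun _ : List (Fin d × ℕ) => ν

variable (ν : Measure (Fin d → Fin d → ℕ)) [IsProbabilityMeasure ν]

instance : IsProbabilityMeasure (genealogyLaw ν) := by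
  unfold genealogyLaw
  infer_instance

/-- The law of the root's offspring array and of the subtrees below its potential children. -/
noncomputable def rootSplitLaw :
    Measure ((Fin d → Fin d → ℕ) × (Fin d × ℕ → Genealogy d)) :=
  ν.prod (Measure.infinitePi fun _ : Fin d × ℕ => genealogyLaw ν)

/-- The branching property: the offspring array of the root and the subtrees below its potential
children are independent, and the subtrees have the law of the whole genealogy. -/
lemma measurePreserving_graft : MeasurePreserving graft (rootSplitLaw ν) (genealogyLaw ν) := by
  refine ⟨measurable_graft, Measure.eq_infinitePi _ fun s t ht => ?_⟩
  have hinj : Function.Injective fun q : (Fin d × ℕ) × List (Fin d × ℕ) => q.1 :: q.2 := by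
    rintro ⟨p, u⟩ ⟨p', u'⟩ h
    simpa using h
  set s' := s.preimage (fun q : (Fin d × ℕ) × List (Fin d × ℕ) => q.1 :: q.2) hinj.injOn with hs'
  set T₀ : Set (Fin d → Fin d → ℕ) := if [] ∈ s then t [] else Set.univ with hT₀
  set T₁ : Set ((Fin d × ℕ) × List (Fin d × ℕ) → Fin d → Fin d → ℕ) :=
    Set.pi s' fun q => t (q.1 :: q.2) with hT₁
  have hT₁m : MeasurableSet T₁ := MeasurableSet.pi s'.countable_toSet fun _ _ => ht _
  have hpre : graft ⁻¹' (Set.pi s t) = T₀ ×ˢ ((MeasurableEquiv.curry (Fin d × ℕ)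
      (List (Fin d × ℕ)) (Fin d → Fin d → ℕ)).symm ⁻¹' T₁) := by
    ext z
    simp only [Set.mem_preimage, Set.mem_pi, SetLike.mem_coe, Set.mem_prod, hT₁, hs',
      Finset.mem_preimage]
    constructor
    · intro h
      refine ⟨?_, fun q hq => h _ hq⟩
      rw [hT₀]
      split_ifs with h0
      · exact h [] h0
      · trivial
    · rintro ⟨h0, h1⟩ u hu
      cases u with
      | nil =>
        rw [hT₀, if_pos hu] at h0
        exact h0
      | cons p u => exact h1 (p, u) hu
  rw [Measure.map_apply measurable_graft (MeasurableSet.pi s.countable_toSet fun _ _ => ht _),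
    hpre, rootSplitLaw, Measure.prod_prod,
    ← Measure.map_apply (MeasurableEquiv.measurable _) hT₁m]
  have hcurry := Measure.infinitePi_map_curry_symm
    (fun (_ : Fin d × ℕ) (_ : List (Fin d × ℕ)) => ν)
  unfold genealogyLaw
  rw [hcurry, hT₁, Measure.infinitePi_pi _ fun q _ => ht _]
  by_cases h0 : [] ∈ s
  · rw [hT₀, if_pos h0, ← Finset.mul_prod_erase s _ h0]
    congr 1
    have hs'' : s' = (s.erase []).preimage
        (fun q : (Fin d × ℕ) × List (Fin d × ℕ) => q.1 :: q.2) hinj.injOn := by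
      ext q
      simp [hs']
    rw [hs'']
    refine Finset.prod_preimage _ _ _ (fun u => ν (t u)) fun u hu hu' => ?_
    cases u with
    | nil => simp at hu
    | cons p u => exact absurd ⟨(p, u), rfl⟩ hu'
  · rw [hT₀, if_neg h0, measure_univ, one_mul, hs']
    refine Finset.prod_preimage _ _ _ (fun u => ν (t u)) fun u hu hu' => ?_
    cases u with
    | nil => exact absurd hu h0
    | cons p u => exact absurd ⟨(p, u), rfl⟩ hu'

/-- The number of type-`k` individuals in the first `n` generations of a genealogy with root of
type `j`. -/
noncomputable def progeny : ℕ → Fin d → Genealogy d → Fin d → ℝ≥0∞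
  | 0, _, _, _ => 0
  | n + 1, j, ω, k => (Pi.single j 1 : Fin d → ℝ≥0∞) k +
      ∑ i, ∑ m ∈ Finset.range (ω [] i j), progeny n i (fun u => ω ((i, m) :: u)) k

/-- The number of type-`k` individuals in a genealogy with root of type `j`. -/
noncomputable def totalProgeny (j : Fin d) (ω : Genealogy d) (k : Fin d) : ℝ≥0∞ :=
  ⨆ n, progeny n j ω k

lemma progeny_le_succ (n : ℕ) : ∀ (j : Fin d) (ω : Genealogy d) (k : Fin d),
    progeny n j ω k ≤ progeny (n + 1) j ω k := by
  induction n with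
  | zero => exact fun _ _ _ => zero_le
  | succ n ih =>
    intro j ω k
    rw [progeny, progeny]
    gcongr
    exact ih _ _ _

lemma monotone_progeny (j : Fin d) (ω : Genealogy d) (k : Fin d) :
    Monotone fun n => progeny n j ω k :=
  monotone_nat_of_le_succ fun n => progeny_le_succ n j ω k

lemma measurable_progeny (n : ℕ) : ∀ j k : Fin d, Measurable fun ω => progeny n j ω k := by
  induction n with
  | zero => exact fun _ _ => measurable_const
  | succ n ih =>
    intro j k
    simp only [progeny]
    refine measurable_const.add (Finset.measurable_fun_sum _ fun i _ => ?_)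
    refine measurable_sum_range (by fun_prop) fun m => (ih i k).comp ?_
    exact measurable_pi_lambda _ fun u => measurable_pi_apply _

lemma measurable_totalProgeny (j k : Fin d) : Measurable fun ω => totalProgeny j ω k :=
  Measurable.iSup fun n => measurable_progeny n j k

lemma totalProgeny_graft (j k : Fin d) (z : (Fin d → Fin d → ℕ) × (Fin d × ℕ → Genealogy d)) :
    totalProgeny j (graft z) k = (Pi.single j 1 : Fin d → ℝ≥0∞) k +
      ∑ i, ∑ m ∈ Finset.range (z.1 i j), totalProgeny i (z.2 (i, m)) k := by
  have h1 : totalProgeny j (graft z) k = ⨆ n, progeny (n + 1) j (graft z) k :=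
    ((monotone_progeny j (graft z) k).iSup_nat_add 1).symm
  have h2 : ∀ n, progeny (n + 1) j (graft z) k = (Pi.single j 1 : Fin d → ℝ≥0∞) k +
      ∑ i, ∑ m ∈ Finset.range (z.1 i j), progeny n i (z.2 (i, m)) k := fun n => rfl
  have h3 : ∀ i, Monotone fun n => ∑ m ∈ Finset.range (z.1 i j), progeny n i (z.2 (i, m)) k :=
    fun i n n' hn => Finset.sum_le_sum fun m _ => monotone_progeny i _ k hn
  rw [h1]
  simp only [h2]
  rw [← ENNReal.add_iSup, ← ENNReal.finsetSum_iSup_of_monotone h3]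
  congr 1
  refine Finset.sum_congr rfl fun i _ => ?_
  exact (ENNReal.finsetSum_iSup_of_monotone fun m => monotone_progeny i _ k).symm

/-- The first-moment recursion shared by the truncated and the total progeny. -/
lemma lintegral_eq_of_graft {f g : Fin d → Genealogy d → ℝ≥0∞} (hf : ∀ i, Measurable (f i))
    (hg : ∀ i, Measurable (g i)) (j : Fin d) (b : ℝ≥0∞)
    (h : ∀ z, g j (graft z) = b + ∑ i, ∑ m ∈ Finset.range (z.1 i j), f i (z.2 (i, m))) :
    ∫⁻ ω, g j ω ∂(genealogyLaw ν)
      = b + ∑ i, (∫⁻ a, (a i j : ℝ≥0∞) ∂ν) * ∫⁻ ω, f i ω ∂(genealogyLaw ν) := by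
  have hN : ∀ i, Measurable fun a : Fin d → Fin d → ℕ => a i j := fun i => by fun_prop
  have hm : ∀ i, Measurable fun z : (Fin d → Fin d → ℕ) × (Fin d × ℕ → Genealogy d) =>
      ∑ m ∈ Finset.range (z.1 i j), f i (z.2 (i, m)) := fun i =>
    measurable_sum_range ((hN i).comp measurable_fst) fun m =>
      (hf i).comp ((measurable_pi_apply _).comp measurable_snd)
  rw [← (measurePreserving_graft ν).lintegral_comp (hg j)]
  simp only [h]
  rw [lintegral_add_left measurable_const, lintegral_finsetSum _ fun i _ => hm i]
  congr 1
  · simp [rootSplitLaw]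
  · refine Finset.sum_congr rfl fun i _ => ?_
    exact lintegral_sum_range_prod ν (fun _ : Fin d × ℕ => genealogyLaw ν) (hN i)
      (fun m => (i, m)) (hf i) fun _ => rfl

lemma lintegral_totalProgeny (j k : Fin d) :
    ∫⁻ ω, totalProgeny j ω k ∂(genealogyLaw ν) = (Pi.single j 1 : Fin d → ℝ≥0∞) k +
      ∑ i, (∫⁻ a, (a i j : ℝ≥0∞) ∂ν) * ∫⁻ ω, totalProgeny i ω k ∂(genealogyLaw ν) :=
  lintegral_eq_of_graft ν (f := fun i ω => totalProgeny i ω k)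
    (g := fun i ω => totalProgeny i ω k) (fun i => measurable_totalProgeny i k)
    (fun i => measurable_totalProgeny i k) j _ fun z => totalProgeny_graft j k z

/-- If every individual has on average at most `1/2` children, the mean total progeny is at most
`∑ 2⁻ⁿ = 2`. -/
lemma lintegral_totalProgeny_le (hν : ∀ j, ∑ i, ∫⁻ a, (a i j : ℝ≥0∞) ∂ν ≤ 2⁻¹) (j k : Fin d) :
    ∫⁻ ω, totalProgeny j ω k ∂(genealogyLaw ν) ≤ 2 := by
  have hn : ∀ n, ∀ j : Fin d, ∫⁻ ω, progeny n j ω k ∂(genealogyLaw ν) ≤ 2 := by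
    intro n
    induction n with
    | zero => simp [progeny]
    | succ n ih =>
      intro j
      rw [lintegral_eq_of_graft ν (f := fun i ω => progeny n i ω k)
        (g := fun i ω => progeny (n + 1) i ω k) (fun i => measurable_progeny n i k)
        (fun i => measurable_progeny (n + 1) i k) j _ fun z => rfl]
      have h1 : (Pi.single j 1 : Fin d → ℝ≥0∞) k ≤ 1 := by
        rcases eq_or_ne k j with rfl | hkj <;> simp [*]
      calc (Pi.single j 1 : Fin d → ℝ≥0∞) k +
            ∑ i, (∫⁻ a, (a i j : ℝ≥0∞) ∂ν) * ∫⁻ ω, progeny n i ω k ∂(genealogyLaw ν)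
          ≤ 1 + ∑ i, (∫⁻ a, (a i j : ℝ≥0∞) ∂ν) * 2 := by
            gcongr with i
            exact ih i
        _ = 1 + (∑ i, ∫⁻ a, (a i j : ℝ≥0∞) ∂ν) * 2 := by rw [Finset.sum_mul]
        _ ≤ 1 + 2⁻¹ * 2 := by
            gcongr
            exact hν j
        _ = 2 := by
            rw [ENNReal.inv_mul_cancel two_ne_zero ENNReal.ofNat_ne_top, one_add_one_eq_two]
  simp only [totalProgeny]
  rw [lintegral_iSup (fun n => measurable_progeny n j k)
    fun n n' h ω => monotone_progeny j ω k h]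
  exact iSup_le fun n => hn n j

/-- The offspring array of the root. -/
def rootOffspring (j i : Fin d) (ω : Genealogy d) : ℕ := ω [] j i

/-- The total progeny as a real vector. -/
noncomputable def realProgeny (j : Fin d) (ω : Genealogy d) (k : Fin d) : ℝ :=
  (totalProgeny j ω k).toReal

lemma measurable_realProgeny (j : Fin d) : Measurable (realProgeny j) :=
  measurable_pi_lambda _ fun k => (measurable_totalProgeny j k).ennreal_toReal

/-- If it has finite mean, the total progeny solves the distributional fixed-point equation. -/
lemma solvesFixedPoint_realProgeny
    (hfin : ∀ j k, ∫⁻ ω, totalProgeny j ω k ∂(genealogyLaw ν) ≠ ∞) :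
    SolvesFixedPoint (genealogyLaw ν) rootOffspring realProgeny := by
  intro j
  change _ = Measure.map (offspringSum j) _
  have hcol : Measurable fun (a : Fin d → Fin d → ℕ) (i : Fin d) => a i j := by fun_prop
  have hroot : (genealogyLaw ν).map (fun ω (i : Fin d) => rootOffspring i j ω)
      = ν.map fun a i => a i j := by
    have h1 := (measurePreserving_eval_infinitePi (fun _ : List (Fin d × ℕ) => ν) []).map_eq
    conv_rhs => rw [← h1, Measure.map_map hcol (measurable_pi_apply _)]
    rfl
  have hprob : ∀ i : Fin d, IsProbabilityMeasure ((genealogyLaw ν).map (realProgeny i)) := fun i =>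
    Measure.isProbabilityMeasure_map (measurable_realProgeny i).aemeasurable
  have hcopies : Measure.infinitePi
        (fun p : Fin d × ℕ => (genealogyLaw ν).map (realProgeny p.1))
      = (Measure.infinitePi fun _ : Fin d × ℕ => genealogyLaw ν).map
          fun η p => realProgeny p.1 (η p) :=
    (Measure.infinitePi_map_pi (fun _ : Fin d × ℕ => genealogyLaw ν)
      (f := fun p => realProgeny p.1) fun p => measurable_realProgeny p.1).symm
  have hcm : Measurable fun (η : Fin d × ℕ → Genealogy d) (p : Fin d × ℕ) =>
      realProgeny p.1 (η p) :=
    measurable_pi_lambda _ fun p => (measurable_realProgeny p.1).comp (measurable_pi_apply p)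
  have hleft : (genealogyLaw ν).map (realProgeny j)
      = (rootSplitLaw ν).map (realProgeny j ∘ graft) := by
    rw [← Measure.map_map (measurable_realProgeny j) measurable_graft,
      (measurePreserving_graft ν).map_eq]
  rw [hroot, hcopies, Measure.map_prod_map _ _ hcol hcm,
    Measure.map_map (measurable_offspringSum j) (hcol.prodMap hcm), hleft]
  refine Measure.map_congr ?_
  have hae : ∀ᵐ z ∂(rootSplitLaw ν), ∀ (p : Fin d × ℕ) (k : Fin d),
      totalProgeny p.1 (z.2 p) k < ∞ := by
    rw [ae_all_iff]
    intro p
    rw [ae_all_iff]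
    intro k
    have h1 : ∀ᵐ ω ∂(genealogyLaw ν), totalProgeny p.1 ω k < ∞ :=
      ae_lt_top (measurable_totalProgeny p.1 k) (hfin p.1 k)
    have h2 := (measurePreserving_eval_infinitePi
      (fun _ : Fin d × ℕ => genealogyLaw ν) p).quasiMeasurePreserving.ae h1
    exact Measure.quasiMeasurePreserving_snd.ae h2
  filter_upwards [hae] with z hz
  ext k
  have hs : (Pi.single j 1 : Fin d → ℝ≥0∞) k ≠ ∞ ∧
      ((Pi.single j 1 : Fin d → ℝ≥0∞) k).toReal = (Pi.single j 1 : Fin d → ℝ) k := by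
    rcases eq_or_ne k j with rfl | hkj <;> simp [*]
  have hterm : ∀ i, ∑ m ∈ Finset.range (z.1 i j), totalProgeny i (z.2 (i, m)) k ≠ ∞ := fun i =>
    (ENNReal.sum_lt_top.2 fun m _ => hz (i, m) k).ne
  rw [Function.comp_apply, Function.comp_apply, offspringSum_apply, realProgeny,
    totalProgeny_graft, ENNReal.toReal_add hs.1 (ENNReal.sum_ne_top.2 fun i _ => hterm i), hs.2,
    ENNReal.toReal_sum fun i _ => hterm i]
  congr 1
  refine Finset.sum_congr rfl fun i _ => ?_
  rw [ENNReal.toReal_sum fun m _ => (hz (i, m) k).ne]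
  rfl

end Tree


/-! ### An admissible model with discrete Pareto offspring counts -/

/-- The law on `ℕ` with tail `P(X > m) = (m + 2) ^ (-β)`, realised as the law of
`⌊U ^ (-1 / β)⌋ - 1` for a uniform variable `U` on `(0, 1)`. -/
noncomputable def discretePareto (β : ℝ) : Measure ℕ :=
  (volume.restrict (Set.Ioo (0 : ℝ) 1)).map fun u => ⌊u ^ (-β)⁻¹⌋₊ - 1

lemma measurable_floor_rpow_sub_one (β : ℝ) :
    Measurable fun u : ℝ => ⌊u ^ (-β)⁻¹⌋₊ - 1 := by
  fun_prop

instance (β : ℝ) : IsProbabilityMeasure (discretePareto β) := by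
  have : IsProbabilityMeasure (volume.restrict (Set.Ioo (0 : ℝ) 1)) := ⟨by simp⟩
  exact Measure.isProbabilityMeasure_map (measurable_floor_rpow_sub_one β).aemeasurable

lemma discretePareto_gt {β : ℝ} (hβ : 0 < β) (m : ℕ) :
    discretePareto β {k | m < k} = ENNReal.ofReal (((m : ℝ) + 2) ^ (-β)) := by
  rw [discretePareto, Measure.map_apply (measurable_floor_rpow_sub_one β) MeasurableSet.of_discrete,
    Measure.restrict_apply ((measurable_floor_rpow_sub_one β) MeasurableSet.of_discrete)]
  have hm2 : (0 : ℝ) < (m : ℝ) + 2 := by positivity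
  have hlt : ((m : ℝ) + 2) ^ (-β) < 1 :=
    Real.rpow_lt_one_of_one_lt_of_neg (by linarith [(Nat.cast_nonneg m : (0 : ℝ) ≤ m)])
      (by linarith)
  have hset : (fun u : ℝ => ⌊u ^ (-β)⁻¹⌋₊ - 1) ⁻¹' {k | m < k} ∩ Set.Ioo 0 1
      = Set.Ioc 0 (((m : ℝ) + 2) ^ (-β)) := by
    ext u
    have key : 0 < u → (m < ⌊u ^ (-β)⁻¹⌋₊ - 1 ↔ u ≤ ((m : ℝ) + 2) ^ (-β)) := fun hu => by
      rw [← Real.le_rpow_inv_iff_of_neg hm2 hu (by linarith), lt_tsub_iff_right]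
      have : m + 1 < ⌊u ^ (-β)⁻¹⌋₊ ↔ m + 2 ≤ ⌊u ^ (-β)⁻¹⌋₊ := Iff.rfl
      rw [this, Nat.le_floor_iff (Real.rpow_nonneg hu.le _)]
      push_cast
      rfl
    simp only [Set.mem_inter_iff, Set.mem_preimage, Set.mem_ofPred_eq, Set.mem_Ioo, Set.mem_Ioc]
    constructor
    · rintro ⟨h1, h2, -⟩
      exact ⟨h2, (key h2).1 h1⟩
    · rintro ⟨h1, h2⟩
      exact ⟨(key h1).2 h2, h1, h2.trans_lt hlt⟩
  rw [hset, Real.volume_Ioc, sub_zero]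

lemma sum_range_rpow_neg_le {β : ℝ} (hβ : 3 ≤ β) (n : ℕ) :
    ∑ m ∈ Finset.range n, ((m : ℝ) + 2) ^ (-β) ≤ 1 / 4 := by
  -- telescoping, as `k ^ (-3) ≤ (1 / ((k - 1) k) - 1 / (k (k + 1))) / 2`
  have h : ∑ m ∈ Finset.range n, ((m : ℝ) + 2) ^ (-β)
      ≤ 1 / 4 - 1 / (2 * ((n : ℝ) + 1) * ((n : ℝ) + 2)) := by
    induction n with
    | zero => norm_num
    | succ n ih =>
      rw [Finset.sum_range_succ]
      have hn : (0 : ℝ) ≤ n := Nat.cast_nonneg n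
      have h1 : ((n : ℝ) + 2) ^ (-β) ≤ 1 / ((n : ℝ) + 2) ^ 3 := by
        calc ((n : ℝ) + 2) ^ (-β) ≤ ((n : ℝ) + 2) ^ (-((3 : ℕ) : ℝ)) :=
              Real.rpow_le_rpow_of_exponent_le (by linarith) (by push_cast; linarith)
          _ = 1 / ((n : ℝ) + 2) ^ 3 := by
              rw [Real.rpow_neg (by positivity), Real.rpow_natCast, one_div]
      have h2 : 1 / ((n : ℝ) + 2) ^ 3 ≤ 1 / (2 * ((n : ℝ) + 1) * ((n : ℝ) + 2))
          - 1 / (2 * ((n : ℝ) + 2) * ((n : ℝ) + 3)) := by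
        have h3 : 1 / (2 * ((n : ℝ) + 1) * ((n : ℝ) + 2))
            - 1 / (2 * ((n : ℝ) + 2) * ((n : ℝ) + 3))
            = 1 / (((n : ℝ) + 1) * ((n : ℝ) + 2) * ((n : ℝ) + 3)) := by
          field_simp
          ring
        rw [h3]
        apply one_div_le_one_div_of_le (by positivity)
        nlinarith
      have h4 : ((n + 1 : ℕ) : ℝ) = (n : ℝ) + 1 := by push_cast; ring
      have h5 : (n : ℝ) + 1 + 1 = n + 2 := by ring
      have h6 : (n : ℝ) + 1 + 2 = n + 3 := by ring
      rw [h4, h5, h6]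
      linarith
  have : 0 ≤ 1 / (2 * ((n : ℝ) + 1) * ((n : ℝ) + 2)) := by positivity
  linarith

lemma lintegral_discretePareto_le {β : ℝ} (hβ : 3 ≤ β) :
    ∫⁻ k, (k : ℝ≥0∞) ∂(discretePareto β) ≤ ENNReal.ofReal (1 / 4) := by
  have h1 : ∀ k : ℕ, (k : ℝ≥0∞) = ∑' m : ℕ, {k : ℕ | m < k}.indicator (fun _ => (1 : ℝ≥0∞)) k := by
    intro k
    rw [tsum_eq_sum (s := Finset.range k) fun m hm => by simpa using hm]
    rw [Finset.sum_congr rfl fun m hm => Set.indicator_of_mem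
      (show k ∈ {k : ℕ | m < k} from Finset.mem_range.1 hm) _]
    simp
  simp only [h1]
  rw [lintegral_tsum fun m => Measurable.of_discrete.aemeasurable]
  refine ENNReal.tsum_le_of_sum_range_le fun n => ?_
  have h2 : ∀ m : ℕ, ∫⁻ k, {k : ℕ | m < k}.indicator (fun _ => (1 : ℝ≥0∞)) k ∂(discretePareto β)
      = ENNReal.ofReal (((m : ℝ) + 2) ^ (-β)) := fun m => by
    rw [lintegral_indicator_const MeasurableSet.of_discrete, one_mul,
      discretePareto_gt (by linarith)]
  simp only [h2]
  rw [← ENNReal.ofReal_sum_of_nonneg fun m _ => by positivity]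
  exact ENNReal.ofReal_le_ofReal (sum_range_rpow_neg_le hβ n)

/-- Convergence of `φ(x) x ^ β` to a positive constant implies regular variation. -/
lemma regularlyVarying_of_tendsto {φ : ℝ → ℝ} {β κ : ℝ}
    (hm : Measurable fun x : Set.Ioi (0 : ℝ) => φ x) (hpos : ∀ x, 0 < x → 0 < φ x) (hκ : 0 < κ)
    (h : Tendsto (fun x => φ x * x ^ β) atTop (𝓝 κ)) : RegularlyVarying φ (-β) := by
  refine ⟨hm, hpos, fun t ht => ?_⟩
  have h1 : Tendsto (fun x => φ (t * x) * (t * x) ^ β) atTop (𝓝 κ) :=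
    h.comp (tendsto_id.const_mul_atTop ht)
  have h2 := (h1.div h hκ.ne').mul_const (t ^ (-β))
  rw [div_self hκ.ne', one_mul] at h2
  refine h2.congr' ?_
  filter_upwards [eventually_gt_atTop 0] with x hx
  have hxβ : x ^ β ≠ 0 := (Real.rpow_pos_of_pos hx _).ne'
  have htβ : t ^ β ≠ 0 := (Real.rpow_pos_of_pos ht _).ne'
  have hφ : φ x ≠ 0 := (hpos x hx).ne'
  rw [Pi.div_apply, Real.mul_rpow ht.le hx.le, Real.rpow_neg ht.le]
  field_simp

lemma tendsto_floor_add_two_rpow (β : ℝ) :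
    Tendsto (fun x : ℝ => ((⌊x⌋₊ : ℝ) + 2) ^ (-β) * x ^ β) atTop (𝓝 1) := by
  have h1 : Tendsto (fun x : ℝ => ((⌊x⌋₊ : ℝ) + 2) / x) atTop (𝓝 1) := by
    have := (tendsto_nat_floor_div_atTop (R := ℝ)).add
      ((tendsto_const_nhds (x := (2 : ℝ))).div_atTop tendsto_id)
    rw [add_zero] at this
    exact this.congr fun x => (add_div _ _ _).symm
  have h2 := h1.rpow_const (p := -β) (Or.inl one_ne_zero)
  rw [Real.one_rpow] at h2
  refine h2.congr' ?_
  filter_upwards [eventually_gt_atTop 0] with x hx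
  rw [Real.div_rpow (by positivity) hx.le, Real.rpow_neg hx.le, div_inv_eq_mul]

section Example

variable {d : ℕ} (α : Fin d → Fin d → ℝ)

/-- The law of an offspring array with independent discrete Pareto entries. -/
noncomputable def paretoOffspring : Measure (Fin d → Fin d → ℕ) :=
  Measure.pi fun j => Measure.pi fun i => discretePareto (α j i)

instance : IsProbabilityMeasure (paretoOffspring α) := by
  unfold paretoOffspring
  infer_instance

lemma measurePreserving_entry (j i : Fin d) :
    MeasurePreserving (fun a : Fin d → Fin d → ℕ => a j i) (paretoOffspring α)
      (discretePareto (α j i)) :=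
  (measurePreserving_eval (fun i => discretePareto (α j i)) i).comp
    (measurePreserving_eval (fun j => Measure.pi fun i => discretePareto (α j i)) j)

lemma measurePreserving_root :
    MeasurePreserving (fun ω : Genealogy d => ω []) (genealogyLaw (paretoOffspring α))
      (paretoOffspring α) :=
  measurePreserving_eval_infinitePi (fun _ : List (Fin d × ℕ) => paretoOffspring α) []

lemma measurePreserving_rootOffspring (j i : Fin d) :
    MeasurePreserving (rootOffspring j i) (genealogyLaw (paretoOffspring α))
      (discretePareto (α j i)) :=
  (measurePreserving_entry α j i).comp (measurePreserving_root α)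

lemma iIndepFun_rootOffspring (i : Fin d) :
    iIndepFun (fun j => rootOffspring j i) (genealogyLaw (paretoOffspring α)) := by
  have h1 : iIndepFun (fun (j : Fin d) (a : Fin d → Fin d → ℕ) => a j i) (paretoOffspring α) :=
    iIndepFun_pi (X := fun (_ : Fin d) (row : Fin d → ℕ) => row i) fun j =>
      (measurable_pi_apply i).aemeasurable
  have h2 := h1.map_fun_eq_pi_map fun j => (measurePreserving_entry α j i).measurable.aemeasurable
  rw [iIndepFun_iff_map_fun_eq_pi_map
    fun j => (measurePreserving_rootOffspring α j i).measurable.aemeasurable]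
  simp only [(measurePreserving_rootOffspring α _ i).map_eq]
  simp only [(measurePreserving_entry α _ i).map_eq] at h2
  rw [← h2, ← (measurePreserving_root α).map_eq, Measure.map_map (by fun_prop) (by fun_prop),
    (measurePreserving_root α).map_eq]
  rfl

variable {α}

lemma tail_rootOffspring (hα : ∀ j i, 0 < α j i) (j i : Fin d) {x : ℝ} (hx : 0 ≤ x) :
    tail (genealogyLaw (paretoOffspring α)) rootOffspring j i x
      = ((⌊x⌋₊ : ℝ) + 2) ^ (-α j i) := by
  have h1 : {ω : Genealogy d | x < (rootOffspring j i ω : ℝ)}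
      = rootOffspring j i ⁻¹' {k | ⌊x⌋₊ < k} := by
    ext ω
    exact (Nat.floor_lt hx).symm
  rw [tail, h1, Measure.real, (measurePreserving_rootOffspring α j i).measure_preimage
    MeasurableSet.of_discrete.nullMeasurableSet, discretePareto_gt (hα j i),
    ENNReal.toReal_ofReal (by positivity)]

lemma tendsto_tail_rootOffspring (hα : ∀ j i, 0 < α j i) (j i : Fin d) :
    Tendsto (fun x : ℝ => tail (genealogyLaw (paretoOffspring α)) rootOffspring j i x * x ^ α j i)
      atTop (𝓝 1) := by
  refine (tendsto_floor_add_two_rpow (α j i)).congr' ?_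
  filter_upwards [eventually_ge_atTop 0] with x hx
  rw [tail_rootOffspring hα j i hx]

lemma regularlyVarying_tail_rootOffspring (hα : ∀ j i, 0 < α j i) (j i : Fin d) :
    RegularlyVarying (tail (genealogyLaw (paretoOffspring α)) rootOffspring j i) (-α j i) := by
  refine regularlyVarying_of_tendsto (Measurable.comp (g := tail _ rootOffspring j i) ?_
    measurable_subtype_coe) (fun x hx => ?_) one_pos (tendsto_tail_rootOffspring hα j i)
  · refine Antitone.measurable fun x y hxy => ?_
    exact measureReal_mono fun ω (hω : y < _) => hxy.trans_lt hω
  · rw [tail_rootOffspring hα j i hx.le]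
    positivity

lemma lintegral_rootOffspring (j i : Fin d) :
    ∫⁻ ω, (rootOffspring j i ω : ℝ≥0∞) ∂(genealogyLaw (paretoOffspring α))
      = ∫⁻ k, (k : ℝ≥0∞) ∂(discretePareto (α j i)) :=
  (measurePreserving_rootOffspring α j i).lintegral_comp (f := fun k : ℕ => (k : ℝ≥0∞))
    Measurable.of_discrete

lemma lintegral_entry (j i : Fin d) :
    ∫⁻ a, (a j i : ℝ≥0∞) ∂(paretoOffspring α) = ∫⁻ k, (k : ℝ≥0∞) ∂(discretePareto (α j i)) :=
  (measurePreserving_entry α j i).lintegral_comp (f := fun k : ℕ => (k : ℝ≥0∞))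
    Measurable.of_discrete

lemma meanMatrix_rootOffspring_mem (hα : ∀ j i, 3 ≤ α j i) (j i : Fin d) :
    meanMatrix (genealogyLaw (paretoOffspring α)) rootOffspring j i ∈ Set.Icc 0 (1 / 4) := by
  refine ⟨integral_nonneg fun ω => Nat.cast_nonneg _, ?_⟩
  have h1 : ∫ ω, (rootOffspring j i ω : ℝ) ∂(genealogyLaw (paretoOffspring α))
      = (∫⁻ k, (k : ℝ≥0∞) ∂(discretePareto (α j i))).toReal := by
    rw [integral_eq_lintegral_of_nonneg_ae (ae_of_all _ fun ω => Nat.cast_nonneg _)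
      ((measurable_from_top (f := fun k : ℕ => (k : ℝ))).comp
        (measurePreserving_rootOffspring α j i).measurable).aestronglyMeasurable,
      ← lintegral_rootOffspring]
    simp only [ENNReal.ofReal_natCast]
  exact h1.trans_le (ENNReal.toReal_le_of_le_ofReal (by norm_num)
    (lintegral_discretePareto_le (hα j i)))

/-- By Gershgorin's theorem, a `2 × 2` matrix with entries of modulus at most `1/4` has spectral
radius at most `1/2`. -/
lemma spectralRadius_lt_one_of_norm_le {M : Matrix (Fin 2) (Fin 2) ℂ}
    (hM : ∀ i j, ‖M i j‖ ≤ 1 / 4) : spectralRadius ℂ M < 1 := by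
  refine lt_of_le_of_lt (b := ((1 / 2 : NNReal) : ℝ≥0∞)) (iSup₂_le fun z hz => ?_) ?_
  · rw [← Matrix.spectrum_toLin', ← Module.End.hasEigenvalue_iff_mem_spectrum] at hz
    obtain ⟨k, hk⟩ := eigenvalue_mem_ball hz
    rw [mem_closedBall_iff_norm] at hk
    have h1 : ∑ j ∈ Finset.univ.erase k, ‖M k j‖ ≤ 1 / 4 := by
      refine (Finset.sum_le_card_nsmul _ _ _ fun j _ => hM k j).trans_eq ?_
      simp
    have h2 : ‖z‖ ≤ 1 / 2 := by
      have := norm_le_norm_add_norm_sub' z (M k k)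
      have := hM k k
      linarith
    exact ENNReal.coe_le_coe.2 h2
  · exact_mod_cast (by norm_num : (1 / 2 : NNReal) < 1)

lemma two_lintegral_entry_le {α : Fin 2 → Fin 2 → ℝ} (hα : ∀ j i, 3 ≤ α j i) (j : Fin 2) :
    ∑ i, ∫⁻ a, (a i j : ℝ≥0∞) ∂(paretoOffspring α) ≤ 2⁻¹ := by
  simp only [lintegral_entry]
  calc ∑ i, ∫⁻ k, (k : ℝ≥0∞) ∂(discretePareto (α i j))
      ≤ ∑ _i : Fin 2, ENNReal.ofReal (1 / 4) :=
        Finset.sum_le_sum fun i _ => lintegral_discretePareto_le (hα i j)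
    _ = 2⁻¹ := by
        rw [Fin.sum_univ_two, ← ENNReal.ofReal_add (by norm_num) (by norm_num),
          show (1 / 4 + 1 / 4 : ℝ) = 2⁻¹ by norm_num, ENNReal.ofReal_inv_of_pos two_pos,
          ENNReal.ofReal_ofNat]

/-- Discrete Pareto offspring counts with distinct indices at least `3` satisfy the standing
assumptions. -/
lemma standingAssumptions_pareto {α : Fin 2 → Fin 2 → ℝ} (hα : ∀ j i, 3 ≤ α j i)
    (hd : ∀ p q : Fin 2 × Fin 2, p ≠ q → α p.1 p.2 ≠ α q.1 q.2) :
    StandingAssumptions (genealogyLaw (paretoOffspring α)) α rootOffspring realProgeny := by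
  have hα0 : ∀ j i, 0 < α j i := fun j i => by linarith [hα j i]
  have hle := lintegral_totalProgeny_le (paretoOffspring α) (two_lintegral_entry_le hα)
  have hfin : ∀ j k, ∫⁻ ω, totalProgeny j ω k ∂(genealogyLaw (paretoOffspring α)) ≠ ∞ :=
    fun j k => ((hle j k).trans_lt ENNReal.ofNat_lt_top).ne
  have hentry : ∀ j i, 0 < ∫⁻ a, (a j i : ℝ≥0∞) ∂(paretoOffspring α) := fun j i => by
    rw [lintegral_entry, lintegral_pos_iff_support Measurable.of_discrete]
    have h0 := discretePareto_gt (hα0 j i) 0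
    have h1 : {k : ℕ | 0 < k} ⊆ Function.support fun k : ℕ => (k : ℝ≥0∞) := fun k hk => by
      have : k ≠ 0 := (show 0 < k from hk).ne'
      simpa using this
    refine lt_of_lt_of_le ?_ (measure_mono h1)
    rw [h0]
    simpa using by positivity
  have hself : ∀ k, 1 ≤ ∫⁻ ω, totalProgeny k ω k ∂(genealogyLaw (paretoOffspring α)) := fun k => by
    rw [lintegral_totalProgeny]
    simp
  refine ⟨fun j i => (measurePreserving_rootOffspring α j i).measurable, measurable_realProgeny,
    fun j => ae_of_all _ fun ω k => ENNReal.toReal_nonneg, solvesFixedPoint_realProgeny _ hfin,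
    spectralRadius_lt_one_of_norm_le fun i j => ?_, fun j i => by linarith [hα j i],
    regularlyVarying_tail_rootOffspring hα0, iIndepFun_rootOffspring α, fun i j => ?_, hd⟩
  · have := meanMatrix_rootOffspring_mem hα i j
    rw [Matrix.map_apply, norm_algebraMap', Real.norm_of_nonneg this.1]
    exact this.2
  · have hpos : 0 < ∫⁻ ω, totalProgeny i ω j ∂(genealogyLaw (paretoOffspring α)) := by
      rw [lintegral_totalProgeny]
      refine lt_of_lt_of_le ?_ le_add_self
      refine lt_of_lt_of_le ?_ (Finset.single_le_sum (fun _ _ => zero_le) (Finset.mem_univ j))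
      exact ENNReal.mul_pos (hentry j i).ne' (one_pos.trans_le (hself j)).ne'
    have h1 : meanS (genealogyLaw (paretoOffspring α)) realProgeny i j
        = (∫⁻ ω, totalProgeny i ω j ∂(genealogyLaw (paretoOffspring α))).toReal :=
      integral_toReal (measurable_totalProgeny i j).aemeasurable
        (ae_lt_top (measurable_totalProgeny i j) (hfin i j))
    rw [h1]
    exact ENNReal.toReal_pos hpos.ne' (hfin i j)

lemma measure_rootOffspring_eq_zero_pos (hα : ∀ j i, 0 < α j i) (j i : Fin d) :
    0 < genealogyLaw (paretoOffspring α) {ω | rootOffspring j i ω = 0} := by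
  have h1 : {ω : Genealogy d | rootOffspring j i ω = 0}
      = rootOffspring j i ⁻¹' {k | 0 < k}ᶜ := by
    ext ω
    simp
  rw [h1, (measurePreserving_rootOffspring α j i).measure_preimage
    MeasurableSet.of_discrete.nullMeasurableSet, prob_compl_eq_one_sub MeasurableSet.of_discrete,
    discretePareto_gt (hα j i), tsub_pos_iff_lt, ← ENNReal.ofReal_one]
  refine (ENNReal.ofReal_lt_ofReal_iff one_pos).2 ?_
  exact Real.rpow_lt_one_of_one_lt_of_neg (by norm_num) (by linarith [hα j i])

end Example

/-- The tail indices `3, 4, 7, 8` meet all requirements of the two-type example. -/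
theorem not_cartesianTailTheorem_two : ¬ CartesianTailTheorem 2 := by
  intro hT
  set α : Fin 2 → Fin 2 → ℝ := ![![3, 4], ![7, 8]] with hα
  have hα3 : ∀ j i, 3 ≤ α j i := fun j i => by
    fin_cases j <;> fin_cases i <;> norm_num [hα]
  have hα0 : ∀ j i, 0 < α j i := fun j i => by linarith [hα3 j i]
  have hd : ∀ p q : Fin 2 × Fin 2, p ≠ q → α p.1 p.2 ≠ α q.1 q.2 := by
    rintro ⟨a, b⟩ ⟨a', b'⟩ hne
    fin_cases a <;> fin_cases b <;> fin_cases a' <;> fin_cases b' <;>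
      first | exact absurd rfl hne | norm_num [hα]
  have h := standingAssumptions_pareto hα3 hd
  obtain ⟨-, -, hr⟩ := two_type_counterexample (c := fun _ _ => 1) h
    (fun j i => ⟨one_pos, tendsto_tail_rootOffspring hα0 j i⟩)
    (by norm_num [hα]) (by norm_num [hα]) (by norm_num [hα]) (by norm_num [hα])
    (measure_rootOffspring_eq_zero_pos hα0 1 0)
  obtain ⟨-, hm, ho, -, hb, -, -, -, -, -, -, hnot⟩ := hr 1 one_pos _ (Or.inl rfl)
  exact hnot (hT _ _ α rootOffspring realProgeny h 0 {1} (Finset.singleton_nonempty 1) _ hm ho hb)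

end BranchingTail

theorem mainTheorem3 :
    (∀ {Ω : Type*} [MeasurableSpace Ω] (P : Measure Ω) [IsProbabilityMeasure P]
      (α c : Fin 2 → Fin 2 → ℝ) (B : Fin 2 → Fin 2 → Ω → ℕ) (S : Fin 2 → Ω → Fin 2 → ℝ),
      StandingAssumptions P α B S →
      (∀ j i, 0 < c j i ∧ Tendsto (fun x : ℝ => tail P B j i x * x ^ α j i) atTop (𝓝 (c j i))) →
      2 < α 0 0 → α 0 0 < α 0 1 → 2 * α 0 0 < α 1 0 → 2 * α 0 0 < α 1 1 →
      0 < P {ω | B 1 0 ω = 0} →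
      2 < alphaStar α 0 ∧ 2 * alphaStar α 0 < alphaStar α 1 ∧
      ∀ r : ℝ, 0 < r → ∀ A : Set (Fin 2 → ℝ),
        (A = offRayVertical (meanS P S 0) r ∨ A = offRay (meanS P S 0) r) →
        -- the lower bound on the decay of the probability
        0 < liminf (fun n : ℕ =>
            ENNReal.ofReal ((n : ℝ) ^ (2 * alphaStar α 0)) * scaledProb P S 0 A n) atTop ∧
        -- the set is admissible in the Cartesian version with `𝐣 = {2}`, but not for any `ε > 0`
        MeasurableSet A ∧ A ⊆ orthant 2 ∧
        coneLe (meanS P S) (tailIndex α) {1} 0 = cone (meanS P S) {0} ∧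
        BoundedAway A (coneLe (meanS P S) (tailIndex α) {1} 0) ∧
        (∀ ε : ℝ, 0 < ε → ¬ BoundedAway A (coneLe (meanS P S) (tailIndex α) {1} ε)) ∧
        -- the Cartesian version would predict a decay of exact order `n ^ (-α*(2))`
        (A ∩ cone (meanS P S) {1}).Nonempty ∧
        (∃ κ : ℝ, 0 < κ ∧
          Tendsto (fun n : ℕ => (n : ℝ) ^ alphaStar α 1 * rate P α B {1} n) atTop (𝓝 κ)) ∧
        0 < limitMeasure α (meanS P S) 0 {1} (orthantInterior A) ∧
        limitMeasure α (meanS P S) 0 {1} (closure A) < ∞ ∧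
        -- this prediction fails
        Tendsto (fun n : ℕ =>
            ENNReal.ofReal ((n : ℝ) ^ alphaStar α 1) * scaledProb P S 0 A n) atTop (𝓝 ∞) ∧
        ¬ TailAsymptotics P α B S 0 {1} A) ∧
    -- hence so does the Cartesian version of the theorem
    ¬ CartesianTailTheorem 2 :=
  ⟨fun _ _ _ _ _ _ h hc h2 h01 h10 h11 hB => two_type_counterexample h hc h2 h01 h10 h11 hB,
    not_cartesianTailTheorem_two⟩
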